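/- Let $F\subset\mathbb C[\mathbf x]=\mathbb C[x_1,\dots,x_n]$ be a finite set of polynomials such that $V_{\mathbb C}(F)=\{v\in\mathbb C^n: f(v)=0\ \forall f\in F\}$ is finite and non-empty; let $I=(F)$ and $\delta=\max_{f\in F}\deg f$. *Notation.* For a set $A$ of monomials (or polynomials) $A^+=A\cup x_1A\cup\dots\cup x_nA$, $\partial A=A^+\setminus A$, $A_s$ is the set of elements of degree $\le s$, $A^{[k]}$ the $k$-fold iterate of $A\mapsto A^+$, $\langle A\rangle$ the linear span, and $\langle A\rangle_s$ its part of degree $\le s$. A finite monomial set $B$ is connected to $1$ if $1\in B$ and every $m\ne1$ in $B$ is $x_im'$ with $m'\in B$. A rewriting family for $B$ is a set $G$ of polynomials supported in $B^+$, each having exactly one monomial $\gamma(g)$ in $\partial B$, with coefficient $1$, and with distinct elements having distinct $\gamma$; it is complete in degree $t$ if $\deg\gamma(g)=\deg g$ for all $g\in G$ and $(\partial B)_t\subset\gamma(G)$. It is a border basis for $B$ ($B$ connected to $1$) if it is complete in all degrees and $\mathbb C[\mathbf x]=\langle B\rangle\oplus(G)$. Reduction by $G$ replaces, repeatedly, a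 monomial $m\notin B$, written $m=\mathbf x^{a}\,x_i\mathbf x^{b}$ with $\mathbf x^b\in B$ and $\mathbf x^{a}$ of least degree, such that $x_i\mathbf x^{b}=\gamma(g)$ with $g\in G$, by $\mathbf x^{a}(\gamma(g)-g)$. The partial map $\pi_{G,B}$ on monomials is given by $\pi(m)=m$ for $m\in B$, $\pi(\gamma(g))=\gamma(g)-g$ for $g\in G$, and $\pi(m)=\pi(x_i\pi(m'))$ for $m\in B^{[k]}\setminus B^{[k-1]}$, $k\ge2$, where $m=x_im'$, $m'\in B^{[k-1]}$, with $i$ smallest possible. For a finite monomial set $S$ and a linear form $\Lambda$ on $\langle S\cdot S\rangle$, put $H_\Lambda^S=(\Lambda(mm'))_{m,m'\in S}$; kernels of matrices indexed by $S$ are viewed in $\langle S\rangle$. *Algorithm over $\mathbb C$.* Start with $t=0$, $B=\{1\}$, $G=\emptyset$ and repeat: (1′) Choose an inclusion-maximal $S\subset B_{t+1}$ such that $\pi_{G,B}(m)$ exists and lies in $\langle B\rangle_{t+1}$ for all $m\in S\cdot S$. Choose a linear form $\Lambda$ on $\langle S\cdot S\rangle$ that vanishes on all $m-\pi_{G,B}(m)$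 with $m\in S\cdot S$, $\pi_{G,B}(m)\in\langle S\cdot S\rangle$, and for which $\operatorname{rank}H_\Lambda^S$ is maximal among all such forms; let $K$ be a basis of $\ker H_\Lambda^S$. (1) Let $\tilde F\subset\langle B^+\rangle_{t+1}$ consist of a full reduction by $G$ of each element of $F_{t+1}$. (2) Let $t'=\min\{\deg p: 0\ne p\in\tilde F\cup K\}-1$, or $t'=t$ if $\tilde F\cup K\subset\{0\}$. (3) Let $W=\langle G^+,\tilde F,K\rangle\cap\langle B^+\rangle_{t'+1}$. (4) Choose $t''\le t'$ maximal such that there is $\tilde B\subset (B^+)_{t''+1}$ connected to $1$ with $\langle B^+\rangle_s=\langle\tilde B\rangle_s\oplus W_s$ and $\langle B\rangle_s=\langle B\cap\tilde B\rangle_s\oplus(W\cap\langle B\rangle_s)$ for all $s\le t''+1$ (that is, only leading monomials of elements of $W\cap\langle B\rangle$ are removed from $B$), and choose such a $\tilde B$. (5) Let $G''\subset W_{t''+1}$ be the rewriting family for $\tilde B$ that is complete in degree $t''+1$. (6) If $G''\ne G$ or $\tilde B\ne B$ or $t''<\delta$, replace $(t,B,G)$ by $(t''+1,\tilde B,G'')$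 and repeat. (7) (Socle) For $B=\{b_1,\dots,b_r\}$ and the last $\Lambda$, with $H=H_\Lambda^B$ required to be invertible, let $(d_1,\dots,d_r)=H^{-1}(b_1,\dots,b_r)$, $\Delta=\sum_ib_id_i$, $H_\Delta=(\Lambda(\Delta b_ib_j))_{i,j}$, where $\Delta b_ib_j$ is first reduced by $G$ into $\langle B\rangle$, and let $G'$ be a finite set spanning $\ker H_\Delta$. Apply the border basis (normal form) algorithm to $G'\cup G$ and output its result; this is the loop above run on $G'\cup G$ in place of $F$ with $K=\emptyset$, without (1′) and (7), and with $t''+1$ in (4) equal to the least degree of a nonzero element of $W\cap\langle B\rangle$ (or $t''=t'$ if $W\cap\langle B\rangle=0$). *Claim.* Whatever choices are made, the algorithm terminates: there is no infinite run, a run can always be continued until it produces an output, and an output is reached. Every output $(B,G)$ is such that $B$ is connected to $1$, $G$ is a border basis for $B$, $(G)=\sqrt I$, and $\mathbb C[\mathbf x]=\langle B\rangle\oplus\sqrt I$. -/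

import Mathlib

namespace RadicalBorderBasis

open MvPolynomial

noncomputable section

/-- Monomials in `n` variables, written additively: `m` stands for `x ^ m`, `0` for the monomial `1`. -/
abbrev Mon (n : ℕ) := Fin n →₀ ℕ

/-- `ℂ[x₁, …, xₙ]`. -/
abbrev Poly (n : ℕ) := MvPolynomial (Fin n) ℂ

/-! ### Monomial sets, rewriting families, border bases -/

/-- The prolongation `A⁺ = A ∪ x₁ A ∪ … ∪ xₙ A` of a set of monomials. -/
def prolong {n : ℕ} (A : Set (Mon n)) : Set (Mon n) :=
  A ∪ {m | ∃ i : Fin n, ∃ a ∈ A, m = Finsupp.single i 1 + a}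

/-- The border `∂A = A⁺ \ A`. -/
def border {n : ℕ} (A : Set (Mon n)) : Set (Mon n) := prolong A \ A

/-- The elements of `A` of degree at most `s`. -/
def upTo {n : ℕ} (A : Set (Mon n)) (s : ℕ) : Set (Mon n) := {m | m ∈ A ∧ m.degree ≤ s}

/-- The linear span `⟨A⟩` of a set of monomials. -/
abbrev mspan {n : ℕ} (A : Set (Mon n)) : Submodule ℂ (Poly n) := restrictSupport ℂ A

/-- The prolongation `G⁺ = G ∪ x₁ G ∪ … ∪ xₙ G` of a set of polynomials. -/
def polyProlong {n : ℕ} (G : Set (Poly n)) : Set (Poly n) :=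
  G ∪ {p | ∃ i : Fin n, ∃ g ∈ G, p = X i * g}

/-- A set of monomials connected to `1`. -/
def ConnectedToOne {n : ℕ} (B : Set (Mon n)) : Prop :=
  0 ∈ B ∧ ∀ m ∈ B, m ≠ 0 → ∃ i : Fin n, ∃ m' ∈ B, m = Finsupp.single i 1 + m'

/-- `γ(g) = m`: the support of `g` is contained in `B⁺`, `m` is its only monomial in `∂B`,
and the coefficient of `m` is `1`. -/
def IsLead {n : ℕ} (B : Set (Mon n)) (g : Poly n) (m : Mon n) : Prop :=
  m ∈ border B ∧ coeff m g = 1 ∧ ∀ m' ∈ g.support, m' ≠ m → m' ∈ B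

/-- Rewriting families for `B`. -/
def IsRewritingFamily {n : ℕ} (B : Set (Mon n)) (G : Set (Poly n)) : Prop :=
  (∀ g ∈ G, ∃ m, IsLead B g m) ∧
    ∀ g ∈ G, ∀ g' ∈ G, ∀ m, IsLead B g m → IsLead B g' m → g = g'

/-- Rewriting families complete in degree `t`: graded, and every border monomial of degree at
most `t` is a leading monomial. -/
def IsCompleteInDegree {n : ℕ} (B : Set (Mon n)) (G : Set (Poly n)) (t : ℕ) : Prop :=
  IsRewritingFamily B G ∧
    (∀ g ∈ G, ∀ m, IsLead B g m → m.degree = g.totalDegree) ∧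
    ∀ m ∈ border B, m.degree ≤ t → ∃ g ∈ G, IsLead B g m

/-- Border bases: complete in all degrees and `ℂ[x] = ⟨B⟩ ⊕ (G)`. -/
def IsBorderBasis {n : ℕ} (B : Set (Mon n)) (G : Set (Poly n)) : Prop :=
  ConnectedToOne B ∧ (∀ t, IsCompleteInDegree B G t) ∧
    IsCompl (mspan B) ((Ideal.span G).restrictScalars ℂ)

/-! ### Reduction and normal forms -/

/-- One reduction step: a monomial `m ∉ B` of `p`, written `m = x^a · (xᵢ x^b)` with `x^b ∈ B` and
`x^a` of least possible degree, where `xᵢ x^b = γ(g)` for some `g ∈ G`, is rewritten by `g`. -/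
def RedStep {n : ℕ} (B : Set (Mon n)) (G : Set (Poly n)) (p q : Poly n) : Prop :=
  ∃ m ∈ p.support, m ∉ B ∧ ∃ g ∈ G, ∃ a l : Mon n, IsLead B g l ∧ m = a + l ∧
    (∀ i : Fin n, ∀ b ∈ B, ∀ a' : Mon n, m = a' + (Finsupp.single i 1 + b) →
      a.degree ≤ a'.degree) ∧
    q = p - monomial a (coeff m p) * g

/-- `p` can be transformed into `q` by reduction steps. -/
def Reduces {n : ℕ} (B : Set (Mon n)) (G : Set (Poly n)) : Poly n → Poly n → Prop :=
  Relation.ReflTransGen (RedStep B G)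

/-- `q` is a full reduction of `p`: no reduction step applies to `q` any more. -/
def IsFullReduction {n : ℕ} (B : Set (Mon n)) (G : Set (Poly n)) (p q : Poly n) : Prop :=
  Reduces B G p q ∧ ∀ q', ¬ RedStep B G q q'

/-- The projection `π_{G,B}` on monomials as a partial function: `ProjectsTo B G m p` says that
`π_{G,B}(x^m)` exists and equals `p`. In the last clause `k` is the `B`-index of `m`, and the
decomposition `m = xᵢ m'` with `m' ∈ B^[k-1]` has the smallest possible `i`. -/
inductive ProjectsTo {n : ℕ} (B : Set (Mon n)) (G : Set (Poly n)) : Mon n → Poly n → Prop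
  | basis (m : Mon n) : m ∈ B → ProjectsTo B G m (monomial m 1)
  | border (m : Mon n) (g : Poly n) : g ∈ G → IsLead B g m →
      ProjectsTo B G m (monomial m 1 - g)
  | step (m m' : Mon n) (i : Fin n) (k : ℕ) (p : Poly n) (q : Mon n → Poly n) :
      2 ≤ k → m ∈ prolong^[k] B → m ∉ prolong^[k - 1] B →
      m' ∈ prolong^[k - 1] B → m = Finsupp.single i 1 + m' →
      (∀ j < i, ∀ m'' ∈ prolong^[k - 1] B, m ≠ Finsupp.single j 1 + m'') →
      ProjectsTo B G m' p →
      (∀ b ∈ p.support, ProjectsTo B G (Finsupp.single i 1 + b) (q b)) →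
      ProjectsTo B G m (∑ b ∈ p.support, coeff b p • q b)

/-! ### Truncated Hankel operators and generic kernels

A linear form on `⟨S · S⟩` is represented by a linear form on `ℂ[x]`, of which only the values on
`⟨S · S⟩` are used. -/

/-- The set of monomials `S · S`. -/
def prodSet {n : ℕ} (S : Set (Mon n)) : Set (Mon n) := {m | ∃ a ∈ S, ∃ b ∈ S, m = a + b}

/-- The polynomials `x^a x^b - π_{G,B}(x^a x^b)`, for `x^a, x^b ∈ S` such that the projection
exists and lies in `⟨S · S⟩`. -/
def redFamily {n : ℕ} (B : Set (Mon n)) (G : Set (Poly n)) (S : Set (Mon n)) : Set (Poly n) :=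
  {κ | ∃ m ∈ prodSet S, ∃ p, ProjectsTo B G m p ∧ p ∈ mspan (prodSet S) ∧ κ = monomial m 1 - p}

/-- The matrix `(Λ(x^a x^b))` with rows and columns indexed by `S`. -/
def hankel {n : ℕ} (Λ : Poly n →ₗ[ℂ] ℂ) (S : Finset (Mon n)) : Matrix S S ℂ :=
  Matrix.of fun a b => Λ (monomial (a.1 + b.1) 1)

/-- The kernel of a matrix indexed by `S`, as a space of polynomials in `⟨S⟩`. -/
def kerPoly {n : ℕ} {S : Finset (Mon n)} (M : Matrix S S ℂ) : Submodule ℂ (Poly n) :=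
  (LinearMap.ker M.mulVecLin).map
    (Fintype.linearCombination ℂ (fun m : S => (monomial m.1 1 : Poly n)))

/-- `Λ` annihilates the reduction relations on `S`, and its truncated Hankel operator on `⟨S⟩` has
the maximal rank among all such forms. -/
def IsGenericForm {n : ℕ} (B : Set (Mon n)) (G : Set (Poly n)) (S : Finset (Mon n))
    (Λ : Poly n →ₗ[ℂ] ℂ) : Prop :=
  (∀ κ ∈ redFamily B G (S : Set (Mon n)), Λ κ = 0) ∧
    ∀ Λ' : Poly n →ₗ[ℂ] ℂ, (∀ κ ∈ redFamily B G (S : Set (Mon n)), Λ' κ = 0) →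
      (hankel Λ' S).rank ≤ (hankel Λ S).rank

/-- Possible results `K` (with the form `Λ` that was used) of the generic kernel computation. -/
def IsGenericKernel {n : ℕ} (B : Set (Mon n)) (G : Set (Poly n)) (S : Finset (Mon n))
    (Λ : Poly n →ₗ[ℂ] ℂ) (K : Set (Poly n)) : Prop :=
  IsGenericForm B G S Λ ∧ LinearIndepOn ℂ id K ∧ Submodule.span ℂ K = kerPoly (hankel Λ S)

/-! ### One pass through the loop -/

/-- The variables `t`, `B`, `G` of the loop. -/
structure State (n : ℕ) where
  t : ℕ
  B : Finset (Mon n)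
  G : Finset (Poly n)

/-- `t = 0`, `B = {1}`, `G = ∅`. -/
def initState (n : ℕ) : State n := ⟨0, {0}, ∅⟩

/-- `S` is a maximal subset of `B_{t+1}` such that all of `S · S` can be reduced by `G` onto
`⟨B⟩_{t+1}`. -/
def IsMaxReducible {n : ℕ} (s : State n) (S : Finset (Mon n)) : Prop :=
  Maximal (fun T : Finset (Mon n) => (T : Set (Mon n)) ⊆ upTo (s.B : Set (Mon n)) (s.t + 1) ∧
    ∀ m ∈ prodSet (T : Set (Mon n)), ∃ p, ProjectsTo (s.B : Set (Mon n)) (s.G : Set (Poly n)) m p ∧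
      p ∈ mspan (upTo (s.B : Set (Mon n)) (s.t + 1))) S

/-- `Ft` consists of one full reduction by `G`, in `⟨B⁺⟩_{t+1}`, of each `f ∈ F` of degree at
most `t + 1`. -/
def IsReducedInput {n : ℕ} (F : Finset (Poly n)) (s : State n) (Ft : Set (Poly n)) : Prop :=
  ∃ ρ : Poly n → Poly n,
    (∀ f ∈ F, f.totalDegree ≤ s.t + 1 →
      IsFullReduction (s.B : Set (Mon n)) (s.G : Set (Poly n)) f (ρ f) ∧
      ρ f ∈ mspan (upTo (prolong (s.B : Set (Mon n))) (s.t + 1))) ∧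
    Ft = ρ '' {f | f ∈ F ∧ f.totalDegree ≤ s.t + 1}

/-- `d` is the least degree of a nonzero element of `P`, or `d₀` if there is no such element. -/
def IsLeastDegree {n : ℕ} (P : Set (Poly n)) (d₀ d : ℕ) : Prop :=
  (∃ p ∈ P, p ≠ 0 ∧ p.totalDegree = d ∧ ∀ q ∈ P, q ≠ 0 → d ≤ q.totalDegree) ∨
    ((∀ p ∈ P, p = 0) ∧ d = d₀)

/-- The space `⟨G⁺, P⟩ ∩ ⟨B⁺⟩_d`. -/
def newRelations {n : ℕ} (s : State n) (P : Set (Poly n)) (d : ℕ) : Submodule ℂ (Poly n) :=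
  Submodule.span ℂ (polyProlong (s.G : Set (Poly n)) ∪ P) ⊓
    mspan (upTo (prolong (s.B : Set (Mon n))) d)

/-- `B'` is a possible new monomial set for the space of relations `W` in degree `≤ e`: it is
connected to `1`, contained in `(B⁺)_e`, and `⟨B⁺⟩_s = ⟨B'⟩_s ⊕ W_s` for all `s ≤ e`.
The last clause says that `B'` arises by removing from `B` only leading monomials of elements
of `W ∩ ⟨B⟩`. -/
def IsNewBasis {n : ℕ} (B : Finset (Mon n)) (W : Submodule ℂ (Poly n)) (e : ℕ)
    (B' : Finset (Mon n)) : Prop :=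
  ConnectedToOne (B' : Set (Mon n)) ∧
  (B' : Set (Mon n)) ⊆ upTo (prolong (B : Set (Mon n))) e ∧
  (∀ s ≤ e,
    Disjoint (mspan (upTo (B' : Set (Mon n)) s)) (W ⊓ restrictTotalDegree (Fin n) ℂ s) ∧
    mspan (upTo (B' : Set (Mon n)) s) ⊔ (W ⊓ restrictTotalDegree (Fin n) ℂ s) =
      mspan (upTo (prolong (B : Set (Mon n))) s)) ∧
  ∀ s ≤ e,
    mspan (upTo ((B : Set (Mon n)) ∩ (B' : Set (Mon n))) s) ⊔
        (W ⊓ mspan (upTo (B : Set (Mon n)) s)) =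
      mspan (upTo (B : Set (Mon n)) s)

/-- `G'` is the rewriting family for `B'`, complete in degree `e`, contained in `W_e`. -/
def IsNewFamily {n : ℕ} (B' : Finset (Mon n)) (W : Submodule ℂ (Poly n)) (e : ℕ)
    (G' : Finset (Poly n)) : Prop :=
  IsCompleteInDegree (B' : Set (Mon n)) (G' : Set (Poly n)) e ∧
    ∀ g ∈ G', g ∈ W ∧ g.totalDegree ≤ e

/-- One pass (steps (1') to (5)) of the radical border basis loop over `ℂ` from the state `s`,
using the form `Λ`. Here `d = t' + 1`, and `s'` holds the values `t'' + 1`, `B̃`, `G''`. -/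
def RadicalPass {n : ℕ} (F : Finset (Poly n)) (s : State n) (Λ : Poly n →ₗ[ℂ] ℂ)
    (s' : State n) : Prop :=
  ∃ (S : Finset (Mon n)) (K Ft : Set (Poly n)) (d : ℕ),
    IsMaxReducible s S ∧
    IsGenericKernel (s.B : Set (Mon n)) (s.G : Set (Poly n)) S Λ K ∧
    IsReducedInput F s Ft ∧
    IsLeastDegree (Ft ∪ K) (s.t + 1) d ∧
    IsGreatest {e | e ≤ d ∧ ∃ B', IsNewBasis s.B (newRelations s (Ft ∪ K) d) e B'} s'.t ∧
    IsNewBasis s.B (newRelations s (Ft ∪ K) d) s'.t s'.B ∧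
    IsNewFamily s'.B (newRelations s (Ft ∪ K) d) s'.t s'.G

/-- One pass (steps (1) to (5)) of the border basis (normal form) algorithm; again `d = t' + 1`,
and `s'` holds `t'' + 1`, `B̃`, `G''`, where `t'' + 1` is the least degree of a nonzero new
relation in `⟨B⟩`, or `t' + 1` if there is none. -/
def BorderPass {n : ℕ} (F : Finset (Poly n)) (s s' : State n) : Prop :=
  ∃ (Ft : Set (Poly n)) (d : ℕ),
    IsReducedInput F s Ft ∧
    IsLeastDegree Ft (s.t + 1) d ∧
    IsLeastDegree ((newRelations s Ft d ⊓ mspan (s.B : Set (Mon n)) : Submodule ℂ (Poly n)) :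
      Set (Poly n)) d s'.t ∧
    IsNewBasis s.B (newRelations s Ft d) s'.t s'.B ∧
    IsNewFamily s'.B (newRelations s Ft d) s'.t s'.G

/-- The stopping test: `G'' = G`, `B̃ = B` and `t'' ≥ δ = max {deg f | f ∈ F}`
(as `s'.t = t'' + 1`, the last condition reads `δ < s'.t`). -/
def StopTest {n : ℕ} (F : Finset (Poly n)) (s s' : State n) : Prop :=
  s'.G = s.G ∧ s'.B = s.B ∧ F.sup totalDegree < s'.t

/-! ### The socle step -/

/-- `Δ = ∑ bᵢ dᵢ`, where `(d₁, …, d_r) = H⁻¹ (b₁, …, b_r)` is the dual basis of `B` for `Λ`. -/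
def socleDelta {n : ℕ} (B : Finset (Mon n)) (Λ : Poly n →ₗ[ℂ] ℂ) : Poly n :=
  ∑ i : B, monomial i.1 1 * ∑ j : B, (hankel Λ B)⁻¹ i j • (monomial j.1 1 : Poly n)

/-- The first part of the socle step, for `Λ` with invertible Hankel matrix on `B`: the matrix
`H_Δ = (Λ(Δ bᵢ bⱼ))` is computed by reducing `Δ bᵢ bⱼ` by `G` to `⟨B⟩`, `G'` is a finite
generating set of its kernel, and the family `F' = G' ∪ G` is formed. -/
def SocleFamily {n : ℕ} (B : Finset (Mon n)) (G : Finset (Poly n)) (Λ : Poly n →ₗ[ℂ] ℂ)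
    (F' : Finset (Poly n)) : Prop :=
  IsUnit (hankel Λ B).det ∧
  ∃ ρ : B → B → Poly n,
    (∀ i j : B, Reduces (B : Set (Mon n)) (G : Set (Poly n))
        (socleDelta B Λ * monomial i.1 1 * monomial j.1 1) (ρ i j) ∧
      ρ i j ∈ mspan (B : Set (Mon n))) ∧
    ∃ G' : Finset (Poly n),
      Submodule.span ℂ (G' : Set (Poly n)) = kerPoly (Matrix.of fun i j => Λ (ρ i j)) ∧
      (F' : Set (Poly n)) = (G' : Set (Poly n)) ∪ (G : Set (Poly n))

/-! ### The algorithm as a transition system -/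

/-- The algorithm is in its main loop, or about to execute the socle step with arguments `B`, `G`,
`Λ`, or in the normal form algorithm called with input `F'` by the socle step, or it has stopped
with output `B`, `G`. -/
inductive Config (n : ℕ)
  | main (s : State n)
  | socleCall (B : Finset (Mon n)) (G : Finset (Poly n)) (Λ : Poly n →ₗ[ℂ] ℂ)
  | socle (F' : Finset (Poly n)) (s : State n)
  | done (B : Finset (Mon n)) (G : Finset (Poly n))

/-- The transitions of the algorithm on input `F`. -/
inductive Trans {n : ℕ} (F : Finset (Poly n)) : Config n → Config n → Prop
  | loop (s s' : State n) (Λ : Poly n →ₗ[ℂ] ℂ) :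
      RadicalPass F s Λ s' → ¬ StopTest F s s' → Trans F (.main s) (.main s')
  | loopExit (s s' : State n) (Λ : Poly n →ₗ[ℂ] ℂ) :
      RadicalPass F s Λ s' → StopTest F s s' → Trans F (.main s) (.socleCall s.B s.G Λ)
  | socleStart (B : Finset (Mon n)) (G : Finset (Poly n)) (Λ : Poly n →ₗ[ℂ] ℂ)
      (F' : Finset (Poly n)) :
      SocleFamily B G Λ F' → Trans F (.socleCall B G Λ) (.socle F' (initState n))
  | socleLoop (F' : Finset (Poly n)) (s s' : State n) :
      BorderPass F' s s' → ¬ StopTest F' s s' → Trans F (.socle F' s) (.socle F' s')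
  | finish (F' : Finset (Poly n)) (s s' : State n) :
      BorderPass F' s s' → StopTest F' s s' → Trans F (.socle F' s) (.done s.B s.G)

/-- The initial configuration. -/
def start (n : ℕ) : Config n := .main (initState n)

/-- `c` can be reached by the algorithm on input `F`. -/
def Reachable {n : ℕ} (F : Finset (Poly n)) (c : Config n) : Prop :=
  Relation.ReflTransGen (Trans F) (start n) c

end

end RadicalBorderBasis

namespace RadicalBorderBasis

open MvPolynomial

variable {n : ℕ}

/-! Put `J` = √I. Both loops are treated as one kind of pass (`IsPass`), in which every relation
ever added lies in `J`. Four ideas carry the proof.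

Border bases. If B is connected to 1, every border monomial is led by an element of G, and ⟨G⁺⟩ ∩
⟨B⟩ = 0, then multiplication by the variables modulo ⟨G⟩ gives operators on ⟨B⟩. Their commutators
lie in ⟨G⁺⟩ ∩ ⟨B⟩ and therefore vanish. So ⟨B⟩ becomes a ℂ[x]-module that represents the quotient by
(G) (`isCompl_of_disjoint_prolong`).

Generic kernels. Evaluation at a zero v of G is an admissible form E, so Λ + εE is admissible for
every ε and cannot have larger rank than Λ. First order perturbation then makes the quadratic form
of E vanish on ker H_Λ. That quadratic form is p ↦ p(v)², so kernel elements vanish at v, and the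
Nullstellensatz puts them in √I (`eval_eq_zero_of_isGenericForm`).

Termination. Let e₀ be the least degree of a nonzero new relation in ⟨B⟩. Below e₀ a pass changes
nothing, and in degree e₀ it removes a monomial of B. Since new monomials appear only in degree t +
1, each degree loses monomials finitely often, so e₀ tends to infinity along an infinite run
(`eventually_lt`). The limits of B and G then satisfy the border basis criterion and F ⊂ (G). As
ℂ[x]/I has finite dimension, the limit B is finite, so the run is constant from some pass on and the
stopping test must succeed (`exists_stopTest`).

Output. A pass that changes neither B nor G certifies a border basis (`IsPass.of_stable`). At the
exit of the main loop also K = 0 and S = B, so H is invertible and (G) lies between I and √I. With Δ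
built from dual bases, H_Δ is the matrix of the trace form of ℂ[x]/(G), whose kernel in
characteristic 0 is the nilradical; hence G' ∪ G generates √I (`span_socleFamily`), and the normal
form algorithm turns it into a border basis.

The set of zeros is used twice: nonemptiness gives `J ≠ ⊤`, so nonzero relations have positive
degree, and finiteness gives the finite quotient. -/

lemma mem_mspan {A : Set (Mon n)} {p : Poly n} : p ∈ mspan A ↔ ∀ m ∈ p.support, m ∈ A :=
  Iff.rfl

lemma totalDegree_le_iff {p : Poly n} {s : ℕ} :
    p.totalDegree ≤ s ↔ ∀ m ∈ p.support, m.degree ≤ s := by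
  rw [totalDegree_eq, Finset.sup_le_iff]
  simp [Finsupp.card_toMultiset, Finsupp.degree_apply, Finsupp.sum]

lemma mem_mspan_upTo {A : Set (Mon n)} {s : ℕ} {p : Poly n} :
    p ∈ mspan (upTo A s) ↔ p ∈ mspan A ∧ p.totalDegree ≤ s := by
  rw [totalDegree_le_iff, mem_mspan, mem_mspan]
  exact ⟨fun h => ⟨fun m hm => (h m hm).1, fun m hm => (h m hm).2⟩,
    fun h m hm => ⟨h.1 m hm, h.2 m hm⟩⟩

lemma monomial_mem_mspan {A : Set (Mon n)} {m : Mon n} (hm : m ∈ A) (c : ℂ) :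
    (monomial m c : Poly n) ∈ mspan A :=
  (monomial_mem_restrictSupport ℂ).2 (Or.inl hm)

lemma monomial_one_mem_mspan_iff {A : Set (Mon n)} {m : Mon n} :
    (monomial m 1 : Poly n) ∈ mspan A ↔ m ∈ A := by
  simp

lemma mspan_mono {A A' : Set (Mon n)} (h : A ⊆ A') : mspan A ≤ mspan A' :=
  restrictSupport_mono ℂ h

lemma subset_of_mspan_le {A A' : Set (Mon n)} (h : mspan A ≤ mspan A') : A ⊆ A' :=
  fun _ hm => monomial_one_mem_mspan_iff.1 (h (monomial_one_mem_mspan_iff.2 hm))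

lemma mspan_le_iff {A : Set (Mon n)} {U : Submodule ℂ (Poly n)} :
    mspan A ≤ U ↔ ∀ m ∈ A, (monomial m 1 : Poly n) ∈ U := by
  rw [mspan, restrictSupport_eq_span, Submodule.span_le]
  exact ⟨fun h m hm => h ⟨m, hm, rfl⟩, by rintro h _ ⟨m, hm, rfl⟩; exact h m hm⟩

lemma totalDegree_monomial_one (m : Mon n) : (monomial m 1 : Poly n).totalDegree = m.degree := by
  rw [totalDegree_monomial _ one_ne_zero]
  simp [Finsupp.degree_apply, Finsupp.sum]

lemma degree_le_of_mem_support {p : Poly n} {m : Mon n} (hm : m ∈ p.support) :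
    m.degree ≤ p.totalDegree :=
  totalDegree_le_iff.1 le_rfl m hm

lemma subset_prolong (A : Set (Mon n)) : A ⊆ prolong A := Set.subset_union_left

lemma single_add_mem_prolong {A : Set (Mon n)} {a : Mon n} (ha : a ∈ A) (i : Fin n) :
    Finsupp.single i 1 + a ∈ prolong A :=
  Or.inr ⟨i, a, ha, rfl⟩

lemma X_mul_mem_mspan_prolong {A : Set (Mon n)} {p : Poly n} (hp : p ∈ mspan A) (i : Fin n) :
    X i * p ∈ mspan (prolong A) := by
  rw [mem_mspan]
  intro m hm
  rw [support_X_mul, Finset.mem_map] at hm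
  obtain ⟨a, ha, rfl⟩ := hm
  exact single_add_mem_prolong (hp ha) i

lemma monomial_single_add (i : Fin n) (m : Mon n) (c : ℂ) :
    (monomial (Finsupp.single i 1 + m) c : Poly n) = X i * monomial m c := by
  rw [X, monomial_mul, one_mul]

lemma eq_sum_support (p : Poly n) :
    p = ∑ b ∈ p.support, coeff b p • (monomial b 1 : Poly n) := by
  conv_lhs => rw [p.as_sum]
  exact Finset.sum_congr rfl fun b _ => by rw [smul_monomial, smul_eq_mul, mul_one]

/-! ### Leading monomials with respect to a monomial set -/

lemma IsLead.sub_mem {B : Set (Mon n)} {g : Poly n} {m : Mon n} (h : IsLead B g m) :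
    monomial m 1 - g ∈ mspan B := by
  rw [mem_mspan]
  intro m' hm'
  rw [mem_support_iff, coeff_sub, coeff_monomial] at hm'
  by_cases hmm : m = m'
  · subst hmm
    simp [h.2.1] at hm'
  · refine h.2.2 m' ?_ (Ne.symm hmm)
    rw [if_neg hmm, zero_sub, neg_ne_zero] at hm'
    rwa [mem_support_iff]

lemma IsLead.mem_support {B : Set (Mon n)} {g : Poly n} {m : Mon n} (h : IsLead B g m) :
    m ∈ g.support := by
  rw [mem_support_iff, h.2.1]
  exact one_ne_zero

lemma IsLead.mem_mspan_prolong {B : Set (Mon n)} {g : Poly n} {m : Mon n} (h : IsLead B g m) :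
    g ∈ mspan (prolong B) := by
  intro m' hm'
  by_cases hmm : m' = m
  · exact hmm ▸ h.1.1
  · exact subset_prolong B (h.2.2 m' hm' hmm)

lemma IsLead.unique {B : Set (Mon n)} {g : Poly n} {m m' : Mon n} (h : IsLead B g m)
    (h' : IsLead B g m') : m = m' := by
  by_contra hne
  exact h.1.2 (h'.2.2 m h.mem_support hne)

lemma IsLead.of_sub_mem {B : Set (Mon n)} {g : Poly n} {m : Mon n} (hm : m ∈ border B)
    (h : monomial m 1 - g ∈ mspan B) : IsLead B g m := by
  have key : ∀ m', coeff m' (monomial m 1 - g) ≠ 0 → m' ∈ B := fun m' hm' =>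
    h (mem_support_iff.2 hm')
  refine ⟨hm, ?_, fun m' hm' hne => key m' ?_⟩
  · by_contra hc
    refine hm.2 (key m ?_)
    rw [coeff_sub, coeff_monomial, if_pos rfl, sub_ne_zero]
    exact Ne.symm hc
  · rw [coeff_sub, coeff_monomial, if_neg (Ne.symm hne), zero_sub, neg_ne_zero]
    exact mem_support_iff.1 hm'

/-- Elements of `⟨B⁺⟩` are linear combinations of elements of `⟨B⟩` and border monomials. -/
lemma mspan_prolong_le {B : Set (Mon n)} {U : Submodule ℂ (Poly n)} (hB : mspan B ≤ U)
    (hU : ∀ m ∈ border B, (monomial m 1 : Poly n) ∈ U) : mspan (prolong B) ≤ U := by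
  rw [mspan_le_iff]
  intro m hm
  by_cases hmB : m ∈ B
  · exact hB (monomial_mem_mspan hmB 1)
  · exact hU m ⟨hm, hmB⟩

/-! ### The border basis criterion -/

section Criterion

variable {B : Set (Mon n)} {G : Set (Poly n)}

lemma mspan_prolong_eq_sup (hG : ∀ m ∈ border B, ∃ g ∈ G, IsLead B g m) :
    mspan (prolong B) ≤ mspan B ⊔ Submodule.span ℂ G := by
  refine mspan_prolong_le le_sup_left fun m hm => ?_
  obtain ⟨g, hg, hl⟩ := hG m hm
  have := Submodule.add_mem_sup hl.sub_mem (Submodule.subset_span (R := ℂ) hg)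
  rwa [sub_add_cancel] at this

/-- The sum contains 1 and is stable under the variables, because x_i⟨B⟩ ⊂ ⟨B⁺⟩ ⊂ ⟨B⟩ + ⟨G⟩. -/
lemma mspan_sup_ideal_eq_top (h0 : (0 : Mon n) ∈ B)
    (hG : ∀ m ∈ border B, ∃ g ∈ G, IsLead B g m) :
    mspan B ⊔ (Ideal.span G).restrictScalars ℂ = ⊤ := by
  set U := mspan B ⊔ (Ideal.span G).restrictScalars ℂ with hU
  have hspan : Submodule.span ℂ G ≤ (Ideal.span G).restrictScalars ℂ :=
    Submodule.span_le.2 Ideal.subset_span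
  have hX : ∀ p ∈ U, ∀ i, p * X i ∈ U := by
    intro p hp i
    obtain ⟨b, hb, h, hh, rfl⟩ := Submodule.mem_sup.1 hp
    rw [add_mul]
    refine add_mem ?_ (Submodule.mem_sup_right (Ideal.mul_mem_right _ _ hh))
    rw [mul_comm]
    exact (sup_le_sup_left hspan _) (mspan_prolong_eq_sup hG (X_mul_mem_mspan_prolong hb i))
  rw [eq_top_iff]
  intro p _
  induction p using MvPolynomial.induction_on with
  | C a => exact Submodule.mem_sup_left (monomial_mem_mspan h0 a)
  | add p q hp hq => exact add_mem (hp trivial) (hq trivial)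
  | mul_X p i hp => exact hX p (hp trivial) i

/-- The operators of multiplication by a variable on `⟨B⟩`, modulo `⟨G⟩`, extended by zero. -/
lemma exists_mulOperator (hG : ∀ m ∈ border B, ∃ g ∈ G, IsLead B g m) (i : Fin n) :
    ∃ M : Poly n →ₗ[ℂ] Poly n, (∀ p, M p ∈ mspan B) ∧
      (∀ b ∈ mspan B, X i * b - M b ∈ Submodule.span ℂ G) ∧ ∀ m ∉ B, M (monomial m 1) = 0 := by
  classical
  -- The value 0 off B makes the operators total; they then commute on all of ℂ[x] as soon as they
  -- commute on ⟨B⟩.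
  have h : ∀ m : Mon n, ∃ q ∈ mspan B,
      (m ∈ B → X i * (monomial m 1 : Poly n) - q ∈ Submodule.span ℂ G) ∧ (m ∉ B → q = 0) := by
    intro m
    by_cases hm : m ∈ B
    · obtain ⟨q, hq, h, hh, hqh⟩ := Submodule.mem_sup.1 (mspan_prolong_eq_sup hG
        (X_mul_mem_mspan_prolong (monomial_mem_mspan hm 1) i))
      exact ⟨q, hq, fun _ => by rw [← hqh]; simpa using hh, fun h => absurd hm h⟩
    · exact ⟨0, zero_mem _, fun h => absurd h hm, fun _ => rfl⟩
  choose q hq using h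
  have hM : ∀ m, (basisMonomials (Fin n) ℂ).constr ℂ q (monomial m 1) = q m := by
    intro m
    have := (basisMonomials (Fin n) ℂ).constr_basis ℂ q m
    rwa [coe_basisMonomials] at this
  refine ⟨(basisMonomials (Fin n) ℂ).constr ℂ q, fun p => ?_, fun b hb => ?_, fun m hm => ?_⟩
  · rw [eq_sum_support p, map_sum]
    refine sum_mem fun m _ => ?_
    rw [map_smul, hM]
    exact Submodule.smul_mem _ _ (hq m).1
  · suffices h : mspan B ≤ (Submodule.span ℂ G).comap
      (LinearMap.mulLeft ℂ (X i) - (basisMonomials (Fin n) ℂ).constr ℂ q) from h hb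
    rw [mspan_le_iff]
    intro m hm
    rw [Submodule.mem_comap, LinearMap.sub_apply, hM]
    exact (hq m).2.1 hm
  · rw [hM, (hq m).2.2 hm]

lemma span_polyProlong_X_mul {h : Poly n} (hh : h ∈ Submodule.span ℂ G) (i : Fin n) :
    X i * h ∈ Submodule.span ℂ (polyProlong G) := by
  induction hh using Submodule.span_induction with
  | mem g hg => exact Submodule.subset_span (Or.inr ⟨i, g, hg, rfl⟩)
  | zero => simp
  | add a b _ _ ha hb => rw [mul_add]; exact add_mem ha hb
  | smul c a _ ha => rw [mul_smul_comm]; exact Submodule.smul_mem _ _ ha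

open scoped IsMulCommutative in
/-- Polynomials can be evaluated at commuting elements of a noncommutative algebra. -/
lemma exists_algHom_of_commute {A : Type*} [Ring A] [Algebra ℂ A] (M : Fin n → A)
    (hM : ∀ i j, M i * M j = M j * M i) : ∃ Ψ : Poly n →ₐ[ℂ] A, ∀ i, Ψ (X i) = M i := by
  have hcomm : ∀ a ∈ Set.range M, ∀ b ∈ Set.range M, a * b = b * a := by
    rintro _ ⟨i, rfl⟩ _ ⟨j, rfl⟩
    exact hM i j
  have := Algebra.isMulCommutative_adjoin ℂ hcomm
  let Φ := aeval (R := ℂ) (S₁ := Algebra.adjoin ℂ (Set.range M))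
    fun i : Fin n => ⟨M i, Algebra.subset_adjoin ⟨i, rfl⟩⟩
  exact ⟨(Algebra.adjoin ℂ (Set.range M)).val.comp Φ, fun i => by simp [Φ]⟩

/-- If `B` is connected to `1`, every border monomial is a leading monomial of `G` and
`⟨G⁺⟩ ∩ ⟨B⟩ = 0`, then `⟨B⟩` is a complement of the ideal `(G)`. -/
theorem isCompl_of_disjoint_prolong (hB : ConnectedToOne B) (hlead : ∀ g ∈ G, ∃ m, IsLead B g m)
    (hG : ∀ m ∈ border B, ∃ g ∈ G, IsLead B g m)
    (hdis : Disjoint (Submodule.span ℂ (polyProlong G)) (mspan B)) :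
    IsCompl (mspan B) ((Ideal.span G).restrictScalars ℂ) := by
  refine ⟨?_, codisjoint_iff.2 (mspan_sup_ideal_eq_top hB.1 hG)⟩
  choose M hMB hM hM0 using exists_mulOperator (n := n) hG
  have hle : Submodule.span ℂ G ≤ Submodule.span ℂ (polyProlong G) :=
    Submodule.span_mono Set.subset_union_left
  have zero_of : ∀ b ∈ mspan B, b ∈ Submodule.span ℂ (polyProlong G) → b = 0 :=
    fun b hb hb' => Submodule.disjoint_def.1 hdis _ hb' hb
  have hMM : ∀ i j, ∀ b ∈ mspan B, X i * (X j * b) - M i (M j b) ∈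
      Submodule.span ℂ (polyProlong G) := by
    intro i j b hb
    have h1 := span_polyProlong_X_mul (hM j b hb) i
    have h2 := hle (hM i (M j b) (hMB j b))
    have h3 := add_mem h1 h2
    rwa [mul_sub, sub_add_sub_cancel] at h3
  have hcomm : ∀ i j, M i * M j = M j * M i := by
    intro i j
    refine (basisMonomials (Fin n) ℂ).ext fun m => ?_
    rw [coe_basisMonomials]
    simp only [Module.End.mul_apply]
    by_cases hm : m ∈ B
    -- The commutator applied to b lies in ⟨B⟩, and modulo ⟨G⁺⟩ both products are x_i x_j b.
    · rw [← sub_eq_zero]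
      have hb := monomial_mem_mspan hm 1
      refine zero_of _ (sub_mem (hMB _ _) (hMB _ _)) ?_
      have h3 := sub_mem (hMM j i _ hb) (hMM i j _ hb)
      rwa [mul_left_comm, sub_sub_sub_cancel_left] at h3
    · rw [hM0 i m hm, hM0 j m hm, map_zero, map_zero]
  obtain ⟨Ψ, hΨX⟩ := exists_algHom_of_commute M hcomm
  -- The normal form map p ↦ p(M₁, …, Mₙ)(1). It fixes ⟨B⟩ because B is connected to 1, and it kills
  -- (G), so ⟨B⟩ ∩ (G) = 0.
  let σ : Poly n →ₗ[ℂ] Poly n := (LinearMap.applyₗ (1 : Poly n)).comp Ψ.toLinearMap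
  have σ_mul : ∀ p q, σ (p * q) = Ψ p (σ q) := by
    intro p q
    simp [σ, map_mul]
  have σ_X : ∀ i q, σ (X i * q) = M i (σ q) := by
    intro i q
    rw [σ_mul, hΨX]
  have σ_one : σ 1 = 1 := by simp [σ]
  have σ_basis : ∀ k, ∀ m ∈ B, m.degree = k → σ (monomial m 1) = monomial m 1 := by
    intro k
    induction k with
    | zero =>
      intro m _ hk
      obtain rfl := (Finsupp.degree_eq_zero_iff m).1 hk
      exact σ_one
    | succ k ih =>
      intro m hm hk
      have hm0 : m ≠ 0 := by rintro rfl; simp at hk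
      obtain ⟨i, m', hm', rfl⟩ := hB.2 m hm hm0
      have hk' : m'.degree = k := by
        rw [map_add, Finsupp.degree_single] at hk
        omega
      rw [monomial_single_add, σ_X, ih m' hm' hk', eq_comm, ← sub_eq_zero]
      refine zero_of _ (sub_mem ?_ (hMB _ _)) (hle (hM i _ (monomial_mem_mspan hm' 1)))
      rw [← monomial_single_add]
      exact monomial_mem_mspan hm 1
  have σ_id : ∀ p ∈ mspan B, σ p = p := by
    have : mspan B ≤ LinearMap.eqLocus σ LinearMap.id := by
      rw [mspan_le_iff]
      intro m hm
      exact σ_basis _ m hm rfl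
    exact fun p hp => this hp
  have σ_G : ∀ g ∈ G, σ g = 0 := by
    intro g hg
    obtain ⟨m, hl⟩ := hlead g hg
    -- With γ(g) = x_i b, σ(g) equals M_i b − (x_i b − g). This lies in ⟨B⟩ and also in ⟨G⟩, since
    -- x_i b − M_i b does.
    obtain ⟨i, b, hb, rfl⟩ := hl.1.1.resolve_left hl.1.2
    have h1 := σ_id _ (monomial_mem_mspan hb 1)
    have h2 := σ_id _ hl.sub_mem
    rw [map_sub, monomial_single_add, σ_X, h1, sub_eq_iff_eq_add, ← sub_eq_iff_eq_add'] at h2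
    have h4 := sub_mem (hle (Submodule.subset_span (R := ℂ) hg))
      (hle (hM i _ (monomial_mem_mspan hb 1)))
    have h5 := hl.sub_mem
    rw [monomial_single_add] at h5
    rw [← h2]
    refine zero_of _ (sub_mem (hMB _ _) h5) ?_
    convert h4 using 1
    ring
  have σ_ideal : ∀ p ∈ Ideal.span G, σ p = 0 := by
    intro p hp
    induction hp using Submodule.span_induction with
    | mem g hg => exact σ_G g hg
    | zero => exact map_zero σ
    | add a b _ _ ha hb => rw [map_add, ha, hb, add_zero]
    | smul c a _ ha => rw [smul_eq_mul, σ_mul, ha, map_zero]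
  rw [Submodule.disjoint_def]
  intro p hp hpI
  rw [← σ_id p hp, σ_ideal p hpI]

end Criterion

/-! ### Reduction -/

section Reduction

variable {B : Set (Mon n)} {G : Set (Poly n)}

lemma exists_single_add_of_ne_zero {m : Mon n} (hm : m ≠ 0) :
    ∃ (i : Fin n) (m' : Mon n), m = Finsupp.single i 1 + m' := by
  obtain ⟨i, hi⟩ := Finsupp.ne_iff.1 hm
  have hle : Finsupp.single i 1 ≤ m := by
    rw [Finsupp.single_le_iff]
    exact Nat.one_le_iff_ne_zero.2 hi
  exact ⟨i, m - Finsupp.single i 1, (add_tsub_cancel_of_le hle).symm⟩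

/-- The distance of a monomial to the monomial set `B`. -/
noncomputable def monIndex (B : Set (Mon n)) (m : Mon n) : ℕ :=
  sInf {k | ∃ a, ∃ b ∈ B, m = a + b ∧ a.degree = k}

lemma monIndex_add_le {a b : Mon n} (hb : b ∈ B) : monIndex B (a + b) ≤ a.degree :=
  Nat.sInf_le ⟨a, b, hb, rfl, rfl⟩

/-- A cofactor realizing the index is not 1; splitting a variable off it leaves a competitor of
degree one less for the cofactor of a reduction step. -/
lemma lt_monIndex (h0 : (0 : Mon n) ∈ B) {m a : Mon n} (hm : m ∉ B)
    (ha : ∀ i : Fin n, ∀ b ∈ B, ∀ a' : Mon n, m = a' + (Finsupp.single i 1 + b) →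
      a.degree ≤ a'.degree) : a.degree < monIndex B m := by
  obtain ⟨c, b, hb, hmb, hc⟩ : monIndex B m ∈ {k | ∃ a, ∃ b ∈ B, m = a + b ∧ a.degree = k} :=
    Nat.sInf_mem ⟨_, m, 0, h0, (add_zero m).symm, rfl⟩
  rw [← hc]
  have hc0 : c ≠ 0 := by
    rintro rfl
    rw [zero_add] at hmb
    exact hm (hmb ▸ hb)
  obtain ⟨i, c', rfl⟩ := exists_single_add_of_ne_zero hc0
  have := ha i b hb c' (by rw [hmb]; abel)
  rw [map_add, Finsupp.degree_single]
  omega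

/-- Rewriting m = x^a γ(g) introduces only monomials x^a b with b ∈ B, whose index is at most deg
x^a and so smaller than that of m. The multiset of indices of the support therefore decreases in the
Dershowitz–Manna order. -/
theorem wellFounded_redStep (h0 : (0 : Mon n) ∈ B) :
    WellFounded fun q p : Poly n => RedStep B G p q := by
  classical
  refine Subrelation.wf ?_ (InvImage.wf (fun p : Poly n => p.support.val.map (monIndex B))
    Multiset.wellFounded_isDershowitzMannaLT)
  rintro q p ⟨m, hm, hmB, g, hg, a, l, hl, hmal, ha, rfl⟩
  set q := p - monomial a (coeff m p) * g with hq
  have hmq : m ∉ q.support := by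
    rw [notMem_support_iff, hq, coeff_sub, hmal, coeff_monomial_mul, hl.2.1, mul_one, sub_self]
  have key : ∀ S T : Finset (Mon n), S.val.map (monIndex B) =
      (S ∩ T).val.map (monIndex B) + (S \ T).val.map (monIndex B) := by
    intro S T
    rw [← Multiset.map_add, ← Finset.disjUnion_val (h := Finset.disjoint_sdiff_inter S T |>.symm)]
    congr 2
    ext x
    simp only [Finset.mem_disjUnion, Finset.mem_inter, Finset.mem_sdiff]
    tauto
  refine ⟨(q.support ∩ p.support).val.map (monIndex B),
    (q.support \ p.support).val.map (monIndex B), (p.support \ q.support).val.map (monIndex B), ?_, key _ _, ?_, ?_⟩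
  · have : monIndex B m ∈ (p.support \ q.support).val.map (monIndex B) :=
      Multiset.mem_map_of_mem _ (Finset.mem_sdiff.2 ⟨hm, hmq⟩)
    intro h
    rw [h] at this
    simp at this
  · rw [Finset.inter_comm]
    exact key _ _
  · intro y hy
    obtain ⟨m', hm', rfl⟩ := Multiset.mem_map.1 hy
    obtain ⟨h1, h2⟩ := Finset.mem_sdiff.1 hm'
    refine ⟨monIndex B m, Multiset.mem_map_of_mem _ (Finset.mem_sdiff.2 ⟨hm, hmq⟩), ?_⟩
    refine lt_of_le_of_lt ?_ (lt_monIndex h0 hmB ha)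
    rw [notMem_support_iff] at h2
    rw [mem_support_iff, hq, coeff_sub, h2, zero_sub, neg_ne_zero, coeff_monomial_mul'] at h1
    split_ifs at h1 with hle
    · have h3 : m' - a ∈ g.support := by
        rw [mem_support_iff]
        exact right_ne_zero_of_mul h1
      have h4 : m' - a ≠ l := by
        intro h
        apply (mem_support_iff.1 hm)
        rw [hmal, ← h, add_tsub_cancel_of_le hle, h2]
      have := monIndex_add_le (a := a) (hl.2.2 _ h3 h4)
      rwa [add_tsub_cancel_of_le hle] at this
    · exact absurd rfl h1

theorem exists_isFullReduction (h0 : (0 : Mon n) ∈ B) (p : Poly n) :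
    ∃ q, IsFullReduction B G p q := by
  induction p using (wellFounded_redStep (G := G) h0).induction with
  | _ p ih =>
    by_cases h : ∃ q, RedStep B G p q
    · obtain ⟨q, hq⟩ := h
      obtain ⟨r, hr⟩ := ih q hq
      exact ⟨r, hr.1.head hq, hr.2⟩
    · exact ⟨p, .refl, not_exists.1 h⟩

/-- Gradedness of G keeps a rewriting step within the degree of the monomial rewritten. The bound on
the generators used matters later, where the limit family is known only degree by degree. -/
lemma RedStep.sub_mem_and_totalDegree_le
    (hgr : ∀ g ∈ G, ∀ m, IsLead B g m → m.degree = g.totalDegree) {p q : Poly n} {N : ℕ}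
    (h : RedStep B G p q) (hp : p.totalDegree ≤ N) :
    q.totalDegree ≤ N ∧ p - q ∈ Ideal.span {g | g ∈ G ∧ g.totalDegree ≤ N} := by
  obtain ⟨m, hm, hmB, g, hg, a, l, hl, hmal, ha, rfl⟩ := h
  have h1 : a.degree + g.totalDegree ≤ N := by
    rw [← hgr g hg l hl, ← map_add, ← hmal]
    exact (degree_le_of_mem_support hm).trans hp
  constructor
  · refine (totalDegree_sub _ _).trans (max_le hp ((totalDegree_mul _ _).trans ?_))
    refine le_trans ?_ h1
    gcongr
    rw [totalDegree_le_iff]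
    intro m' hm'
    rw [Finset.mem_singleton.1 (support_monomial_subset hm')]
  · rw [sub_sub_cancel]
    exact Ideal.mul_mem_left _ _ (Ideal.subset_span ⟨hg, by omega⟩)

lemma Reduces.sub_mem_and_totalDegree_le
    (hgr : ∀ g ∈ G, ∀ m, IsLead B g m → m.degree = g.totalDegree) {p q : Poly n} {N : ℕ}
    (h : Reduces B G p q) (hp : p.totalDegree ≤ N) :
    q.totalDegree ≤ N ∧ p - q ∈ Ideal.span {g | g ∈ G ∧ g.totalDegree ≤ N} := by
  induction h with
  | refl => exact ⟨hp, by simp⟩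
  | tail _ hs ih =>
    obtain ⟨h1, h2⟩ := hs.sub_mem_and_totalDegree_le hgr ih.1
    exact ⟨h1, by simpa using add_mem ih.2 h2⟩

lemma Reduces.sub_mem (hgr : ∀ g ∈ G, ∀ m, IsLead B g m → m.degree = g.totalDegree)
    {p q : Poly n} (h : Reduces B G p q) : p - q ∈ Ideal.span G :=
  Ideal.span_mono (fun _ hg => hg.1) (h.sub_mem_and_totalDegree_le hgr le_rfl).2

/-- Every monomial outside `B` is a multiple of a border monomial, with a cofactor of least
degree. -/
lemma exists_min_cofactor (h0 : (0 : Mon n) ∈ B) {m : Mon n} (hm : m ∉ B) :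
    ∃ a l : Mon n, l ∈ border B ∧ m = a + l ∧
      ∀ i : Fin n, ∀ b ∈ B, ∀ a' : Mon n, m = a' + (Finsupp.single i 1 + b) →
        a.degree ≤ a'.degree := by
  classical
  have hm0 : m ≠ 0 := fun h => hm (h ▸ h0)
  have hex : ∃ k, ∃ a : Mon n, ∃ i : Fin n, ∃ b ∈ B, m = a + (Finsupp.single i 1 + b) ∧
      a.degree = k := by
    obtain ⟨i, m', h⟩ := exists_single_add_of_ne_zero hm0
    exact ⟨_, m', i, 0, h0, by rw [h]; abel, rfl⟩
  obtain ⟨a, i, b, hb, hab, ha⟩ := Nat.find_spec hex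
  have hmin : ∀ i : Fin n, ∀ b ∈ B, ∀ a' : Mon n, m = a' + (Finsupp.single i 1 + b) →
      a.degree ≤ a'.degree := by
    intro j c hc a' h
    rw [ha]
    exact Nat.find_min' hex ⟨a', j, c, hc, h, rfl⟩
  refine ⟨a, Finsupp.single i 1 + b, ⟨single_add_mem_prolong hb i, fun hB => ?_⟩, hab, hmin⟩
  by_cases ha0 : a = 0
  · rw [ha0, zero_add] at hab
    exact hm (hab ▸ hB)
  · obtain ⟨j, a', rfl⟩ := exists_single_add_of_ne_zero ha0
    have := hmin j _ hB a' (by rw [hab]; abel)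
    rw [map_add, Finsupp.degree_single] at this
    omega

/-- The monomials of a polynomial to which no reduction step applies. -/
lemma mem_of_irreducible (h0 : (0 : Mon n) ∈ B) {t : ℕ}
    (hG : ∀ m ∈ border B, m.degree ≤ t → ∃ g ∈ G, IsLead B g m) {q : Poly n}
    (hq : ∀ q', ¬ RedStep B G q q') {m : Mon n} (hm : m ∈ q.support) (hmd : m.degree ≤ t + 1) :
    m ∈ B ∨ m ∈ border B ∧ m.degree = t + 1 := by
  by_contra hcon
  rw [not_or] at hcon
  obtain ⟨a, l, hl, hmal, hmin⟩ := exists_min_cofactor h0 hcon.1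
  by_cases hlt : l.degree ≤ t
  · obtain ⟨g, hg, hgl⟩ := hG l hl hlt
    exact hq _ ⟨m, hm, hcon.1, g, hg, a, l, hgl, hmal, hmin, rfl⟩
  -- The border divisor has degree at least t + 1 while m has degree at most t + 1, so the cofactor
  -- is 1.
  · have : m.degree = a.degree + l.degree := by rw [hmal, map_add]
    have ha : a.degree = 0 := by omega
    rw [Finsupp.degree_eq_zero_iff] at ha
    rw [ha, zero_add] at hmal
    subst hmal
    exact hcon.2 ⟨hl, by omega⟩

lemma exists_reduces_mem_mspan (h0 : (0 : Mon n) ∈ B)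
    (hG : ∀ m ∈ border B, ∃ g ∈ G, IsLead B g m) (p : Poly n) :
    ∃ q ∈ mspan B, Reduces B G p q := by
  obtain ⟨q, hq, hirr⟩ := exists_isFullReduction (G := G) h0 p
  refine ⟨q, fun m hm => ?_, hq⟩
  rcases mem_of_irreducible h0 (t := m.degree) (fun m hm _ => hG m hm) hirr hm (by omega) with h | h
  · exact h
  · omega

/-! ### The projection on monomials -/

lemma ProjectsTo.sub_mem {m : Mon n} {p : Poly n} (h : ProjectsTo B G m p) :
    monomial m 1 - p ∈ Ideal.span G := by
  induction h with
  | basis m hm => simp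
  | border m g hg hl => simpa using Ideal.subset_span hg
  | step m m' i k p q hk h1 h2 h3 hm hmin hp hq ih ihq =>
    have e : monomial m 1 - ∑ b ∈ p.support, coeff b p • q b = X i * (monomial m' 1 - p) +
        ∑ b ∈ p.support, coeff b p • (monomial (Finsupp.single i 1 + b) 1 - q b) := by
      simp only [smul_sub, Finset.sum_sub_distrib, monomial_single_add, hm, ← mul_smul_comm]
      rw [← Finset.mul_sum, ← eq_sum_support]
      ring
    rw [e]
    refine add_mem (Ideal.mul_mem_left _ _ ih) (sum_mem fun b hb => ?_)
    rw [smul_eq_C_mul]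
    exact Ideal.mul_mem_left _ _ (ihq b hb)

lemma exists_projectsTo_of_mem_prolong (hG : ∀ m ∈ border B, ∃ g ∈ G, IsLead B g m) {m : Mon n}
    (hm : m ∈ prolong B) : ∃ p ∈ mspan B, ProjectsTo B G m p := by
  by_cases hmB : m ∈ B
  · exact ⟨_, monomial_mem_mspan hmB 1, .basis m hmB⟩
  · obtain ⟨g, hg, hl⟩ := hG m ⟨hm, hmB⟩
    exact ⟨_, hl.sub_mem, .border m g hg hl⟩

lemma mem_prolong_iterate (h0 : (0 : Mon n) ∈ B) (k : ℕ) :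
    ∀ m : Mon n, m.degree = k → m ∈ prolong^[k] B := by
  induction k with
  | zero =>
    intro m hm
    rwa [(Finsupp.degree_eq_zero_iff m).1 hm]
  | succ k ih =>
    intro m hm
    have hm0 : m ≠ 0 := by rintro rfl; simp at hm
    obtain ⟨i, m', rfl⟩ := exists_single_add_of_ne_zero hm0
    rw [map_add, Finsupp.degree_single] at hm
    rw [Function.iterate_succ_apply']
    exact single_add_mem_prolong (ih m' (by omega)) i

/-- Induction on the B-index: once m' is projected into ⟨B⟩, multiplication by x_i leads only into
⟨B⁺⟩, where G covers every border monomial. -/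
theorem exists_projectsTo (h0 : (0 : Mon n) ∈ B) (hG : ∀ m ∈ border B, ∃ g ∈ G, IsLead B g m)
    (m : Mon n) : ∃ p ∈ mspan B, ProjectsTo B G m p := by
  classical
  suffices h : ∀ k, ∀ m ∈ prolong^[k] B, ∃ p ∈ mspan B, ProjectsTo B G m p from
    h _ m (mem_prolong_iterate h0 _ m rfl)
  intro k
  induction k with
  | zero => exact fun m hm => exists_projectsTo_of_mem_prolong hG (subset_prolong B hm)
  | succ k ih =>
    intro m hm
    by_cases hmk : m ∈ prolong^[k] B
    · exact ih m hmk
    rcases Nat.eq_zero_or_pos k with rfl | hk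
    · exact exists_projectsTo_of_mem_prolong hG hm
    have hex : ∃ i : Fin n, ∃ m' ∈ prolong^[k] B, m = Finsupp.single i 1 + m' := by
      rw [Function.iterate_succ_apply'] at hm
      exact hm.resolve_left hmk
    obtain ⟨m', hm', hmm'⟩ := Fin.find_spec hex
    set i := Fin.find _ hex with hi
    obtain ⟨p, hp, hpp⟩ := ih m' hm'
    have hq : ∀ b : Mon n, ∃ q ∈ mspan B, b ∈ p.support →
        ProjectsTo B G (Finsupp.single i 1 + b) q := by
      intro b
      by_cases hb : b ∈ p.support
      · obtain ⟨q, h1, h2⟩ := exists_projectsTo_of_mem_prolong hG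
          (single_add_mem_prolong (hp hb) i)
        exact ⟨q, h1, fun _ => h2⟩
      · exact ⟨0, zero_mem _, fun h => absurd h hb⟩
    choose q hqB hq using hq
    refine ⟨_, sum_mem fun b _ => Submodule.smul_mem _ _ (hqB b),
      .step m m' i (k + 1) p q (by omega) hm hmk hm' hmm' ?_ hpp hq⟩
    intro j hj m'' hm'' h
    exact Fin.find_min hex hj ⟨m'', hm'', h⟩

end Reduction

/-! ### Generic kernels -/

/-- If the rank of the symmetric matrix `M` does not increase in the direction of `N`, then `N`
vanishes as a quadratic form on the kernel of `M`. -/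
theorem dotProduct_mulVec_eq_zero_of_rank_le {ι : Type*} [Fintype ι] [DecidableEq ι]
    {M N : Matrix ι ι ℂ} (hM : M.transpose = M) (hmax : ∀ ε : ℂ, (M + ε • N).rank ≤ M.rank)
    {u : ι → ℂ} (hu : M.mulVec u = 0) : u ⬝ᵥ N.mulVec u = 0 := by
  by_contra hne
  -- By symmetry the range of M annihilates ker M under the bilinear dot product, so Nu in that
  -- range would give uᵀNu = 0.
  have hnot : N.mulVec u ∉ LinearMap.range M.mulVecLin := by
    rintro ⟨y, hy⟩
    apply hne
    rw [Matrix.mulVecLin_apply] at hy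
    rw [← hy, Matrix.dotProduct_mulVec, ← Matrix.mulVec_transpose, hM, hu, zero_dotProduct]
  let b := Module.finBasis ℂ (LinearMap.range M.mulVecLin)
  have hb : ∀ j, ∃ w : ι → ℂ, M.mulVec w = b j := fun j => (b j).2
  choose w hw using hb
  -- A family of rank(M) + 1 vectors, independent at ε = 0 and hence for small ε. For ε ≠ 0 all of
  -- them lie in the range of M + εN: the first is the image of ε⁻¹u because Mu = 0.
  let fam : ℂ → Fin (_ + 1) → ι → ℂ := fun ε =>
    Fin.cons (N.mulVec u) fun j => M.mulVec (w j) + ε • N.mulVec (w j)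
  have hcont : Continuous fam := by
    refine continuous_pi fun j => ?_
    refine Fin.cases ?_ (fun j => ?_) j
    · exact continuous_const
    · simp only [fam, Fin.cons_succ]
      fun_prop
  have hfam0 : LinearIndependent ℂ (fam 0) := by
    have e : (fun j => M.mulVec (w j) + (0 : ℂ) • N.mulVec (w j)) = fun j => (b j : ι → ℂ) := by
      funext j
      rw [zero_smul, add_zero, hw]
    simp only [fam, e]
    rw [linearIndependent_finCons]
    refine ⟨b.linearIndependent.map' (Submodule.subtype _) (Submodule.ker_subtype _), fun h => ?_⟩
    refine hnot (Submodule.span_le.2 ?_ h)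
    rintro _ ⟨j, rfl⟩
    exact (b j).2
  have hev : ∀ᶠ ε in nhdsWithin (0 : ℂ) {0}ᶜ, LinearIndependent ℂ (fam ε) :=
    (hcont.continuousAt.eventually hfam0.eventually).filter_mono nhdsWithin_le_nhds
  obtain ⟨ε, hε, hε0⟩ := (hev.and self_mem_nhdsWithin).exists
  have hsub : Submodule.span ℂ (Set.range (fam ε)) ≤ LinearMap.range (M + ε • N).mulVecLin := by
    rw [Submodule.span_le]
    rintro _ ⟨j, rfl⟩
    refine Fin.cases ⟨ε⁻¹ • u, ?_⟩ (fun j => ⟨w j, ?_⟩) j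
    · simp [fam, hu, smul_smul, inv_mul_cancel₀ (show ε ≠ 0 from hε0)]
    · simp [fam]
  have h1 := Submodule.finrank_mono hsub
  rw [finrank_span_eq_card hε, Fintype.card_fin] at h1
  have h2 := hmax ε
  rw [Matrix.rank, Matrix.rank] at h2
  omega

lemma hankel_transpose (Λ : Poly n →ₗ[ℂ] ℂ) (S : Finset (Mon n)) :
    (hankel Λ S).transpose = hankel Λ S := by
  ext a b
  simp [hankel, add_comm]

lemma mem_kerPoly {S : Finset (Mon n)} {M : Matrix S S ℂ} {p : Poly n} :
    p ∈ kerPoly M ↔ ∃ u : S → ℂ, M.mulVec u = 0 ∧ ∑ m : S, u m • (monomial m.1 1 : Poly n) = p := by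
  simp [kerPoly, Fintype.linearCombination_apply]

lemma kerPoly_le_mspan {S : Finset (Mon n)} (M : Matrix S S ℂ) :
    kerPoly M ≤ mspan (S : Set (Mon n)) := by
  intro p hp
  obtain ⟨u, -, rfl⟩ := mem_kerPoly.1 hp
  exact sum_mem fun m _ => Submodule.smul_mem _ _ (monomial_mem_mspan m.2 1)

/-- The polynomials in a generic kernel vanish at the zeros of `G`. -/
theorem eval_eq_zero_of_isGenericForm {B : Set (Mon n)} {G : Set (Poly n)} {S : Finset (Mon n)}
    {Λ : Poly n →ₗ[ℂ] ℂ} (hΛ : IsGenericForm B G S Λ) {v : Fin n → ℂ}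
    (hv : ∀ g ∈ G, eval v g = 0) {p : Poly n} (hp : p ∈ kerPoly (hankel Λ S)) : eval v p = 0 := by
  obtain ⟨u, hu, rfl⟩ := mem_kerPoly.1 hp
  let E : Poly n →ₗ[ℂ] ℂ := (aeval v : Poly n →ₐ[ℂ] ℂ).toLinearMap
  have hE : ∀ q, E q = eval v q := fun q => by simp [E]
  have hG : ∀ q ∈ Ideal.span G, eval v q = 0 := by
    intro q hq
    have : Ideal.span G ≤ RingHom.ker (eval v) := Ideal.span_le.2 hv
    exact this hq
  have hEκ : ∀ κ ∈ redFamily B G (S : Set (Mon n)), E κ = 0 := by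
    rintro _ ⟨m, -, p, hp, -, rfl⟩
    rw [hE]
    exact hG _ hp.sub_mem
  have hmax : ∀ ε : ℂ, (hankel Λ S + ε • hankel E S).rank ≤ (hankel Λ S).rank := by
    intro ε
    have e : hankel Λ S + ε • hankel E S = hankel (Λ + ε • E) S := by
      ext a b
      simp [hankel]
    rw [e]
    refine hΛ.2 _ fun κ hκ => ?_
    simp [hΛ.1 κ hκ, hEκ κ hκ]
  have h := dotProduct_mulVec_eq_zero_of_rank_le (hankel_transpose Λ S) hmax hu
  have hmon : ∀ a b : Mon n, E (monomial (a + b) 1) =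
      eval v (monomial a 1) * eval v (monomial b 1) := by
    intro a b
    rw [hE, ← map_mul, monomial_mul, one_mul]
  -- No complex conjugates occur, so the quadratic form of evaluation is p(v)² and not |p(v)|².
  have hsq : u ⬝ᵥ (hankel E S).mulVec u =
      (eval v (∑ m : S, u m • (monomial m.1 1 : Poly n))) ^ 2 := by
    simp only [dotProduct, Matrix.mulVec, hankel, Matrix.of_apply, hmon, map_sum, smul_eval]
    rw [sq, Finset.sum_mul]
    refine Finset.sum_congr rfl fun a _ => ?_
    rw [mul_assoc, Finset.mul_sum, Finset.mul_sum, Finset.mul_sum]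
    exact Finset.sum_congr rfl fun b _ => by ring
  rw [hsq] at h
  exact pow_eq_zero_iff (two_ne_zero) |>.1 h

lemma exists_isGenericKernel (B : Set (Mon n)) (G : Set (Poly n)) (S : Finset (Mon n)) :
    ∃ Λ K, IsGenericKernel B G S Λ K := by
  classical
  let P : ℕ → Prop := fun r => ∃ Λ : Poly n →ₗ[ℂ] ℂ,
    (∀ κ ∈ redFamily B G (S : Set (Mon n)), Λ κ = 0) ∧ (hankel Λ S).rank = r
  have hP0 : P _ := ⟨0, fun _ _ => rfl, rfl⟩
  have hbd : ∀ r, P r → r ≤ Fintype.card S := by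
    rintro _ ⟨Λ, -, rfl⟩
    exact Matrix.rank_le_card_width _
  obtain ⟨Λ, h1, h2⟩ := Nat.findGreatest_spec (hbd _ hP0) hP0
  obtain ⟨K, -, hK, hli⟩ := exists_linearIndependent ℂ (kerPoly (hankel Λ S) : Set (Poly n))
  refine ⟨Λ, K, ⟨h1, fun Λ' hΛ' => ?_⟩, hli, by rw [hK, Submodule.span_eq]⟩
  rw [h2]
  have hP' : P (hankel Λ' S).rank := ⟨Λ', hΛ', rfl⟩
  exact Nat.le_findGreatest (hbd _ hP') hP'

/-! ### Zero-dimensional ideals -/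

lemma mem_radical_of_forall_eval {F : Set (Poly n)} {p : Poly n}
    (h : ∀ v : Fin n → ℂ, (∀ f ∈ F, eval v f = 0) → eval v p = 0) :
    p ∈ (Ideal.span F).radical := by
  rw [← vanishingIdeal_zeroLocus_eq_radical (K := ℂ)]
  intro v hv
  rw [aeval_eq_eval]
  refine h v fun f hf => ?_
  have := hv f (Ideal.subset_span hf)
  rwa [aeval_eq_eval] at this

lemma eval_eq_zero_of_mem_radical {F : Set (Poly n)} {p : Poly n}
    (hp : p ∈ (Ideal.span F).radical) {v : Fin n → ℂ} (hv : ∀ f ∈ F, eval v f = 0) :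
    eval v p = 0 := by
  obtain ⟨k, hk⟩ := hp
  have : Ideal.span F ≤ RingHom.ker (eval v) := Ideal.span_le.2 hv
  have h := this hk
  rw [RingHom.mem_ker, map_pow] at h
  exact eq_zero_of_pow_eq_zero h

/-- The product of the x_i − v_i over all zeros v lies in √I; a power of it lies in I and is a monic
equation for x_i in the quotient, which is thus integral and finitely generated over ℂ. -/
theorem finite_quotient_of_finite_zeros {F : Set (Poly n)}
    (hfin : {v : Fin n → ℂ | ∀ f ∈ F, eval v f = 0}.Finite) :
    Module.Finite ℂ (Poly n ⧸ Ideal.span F) := by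
  have hX : ∀ i : Fin n, IsIntegral ℂ (Ideal.Quotient.mkₐ ℂ (Ideal.span F) (X i)) := by
    intro i
    let P : Polynomial ℂ := ∏ v ∈ hfin.toFinset, (Polynomial.X - Polynomial.C (v i))
    have hmem : Polynomial.aeval (X i : Poly n) P ∈ (Ideal.span F).radical := by
      refine mem_radical_of_forall_eval fun v hv => ?_
      simp only [P, map_prod, map_sub, Polynomial.aeval_X, Polynomial.aeval_C]
      refine Finset.prod_eq_zero (hfin.mem_toFinset.2 hv) ?_
      simp [algebraMap_eq]
    obtain ⟨k, hk⟩ := hmem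
    refine ⟨P ^ k, (Polynomial.monic_prod_of_monic _ _ fun v _ =>
      Polynomial.monic_X_sub_C _).pow k, ?_⟩
    rw [← map_pow] at hk
    rw [← Polynomial.aeval_def, Polynomial.aeval_algHom_apply]
    exact Ideal.Quotient.eq_zero_iff_mem.2 hk
  have : Algebra.IsIntegral ℂ (Poly n ⧸ Ideal.span F) := by
    refine ⟨fun x => ?_⟩
    obtain ⟨p, rfl⟩ := Ideal.Quotient.mkₐ_surjective ℂ (Ideal.span F) x
    induction p using MvPolynomial.induction_on with
    | C a =>
      rw [← algebraMap_eq, AlgHom.commutes]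
      exact isIntegral_algebraMap
    | add p q hp hq => rw [map_add]; exact hp.add hq
    | mul_X p i hp => rw [map_mul]; exact hp.mul (hX i)
  exact Algebra.IsIntegral.finite

lemma linearIndependent_mk_monomial {B : Set (Mon n)} {J : Ideal (Poly n)}
    (h : Disjoint (mspan B) (J.restrictScalars ℂ)) :
    LinearIndependent ℂ fun b : B => Ideal.Quotient.mkₐ ℂ J (monomial b.1 1) := by
  have h1 : LinearIndependent ℂ fun b : B => (monomial b.1 1 : Poly n) := by
    have := (basisMonomials (Fin n) ℂ).linearIndependent.comp (Subtype.val : B → Mon n)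
      Subtype.val_injective
    simpa [Function.comp_def] using this
  refine h1.map (f := (Ideal.Quotient.mkₐ ℂ J).toLinearMap) (h.mono ?_ ?_)
  · rw [Submodule.span_le]
    rintro _ ⟨b, rfl⟩
    exact monomial_mem_mspan b.2 1
  · intro p hp
    exact Ideal.Quotient.eq_zero_iff_mem.1 hp

lemma finite_of_disjoint {B : Set (Mon n)} {J : Ideal (Poly n)} [Module.Finite ℂ (Poly n ⧸ J)]
    (h : Disjoint (mspan B) (J.restrictScalars ℂ)) : B.Finite := by
  have := (linearIndependent_mk_monomial h).finite
  exact Set.toFinite B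

/-! ### The trace form and the socle -/

/-- In a finite commutative algebra over `ℂ` the radical of the trace form is the nilradical. -/
theorem isNilpotent_iff_trace_mul_eq_zero {A : Type*} [CommRing A] [Algebra ℂ A]
    [Module.Finite ℂ A] (x : A) : IsNilpotent x ↔ ∀ y, Algebra.trace ℂ A (x * y) = 0 := by
  constructor
  · intro hx y
    exact (Algebra.isNilpotent_trace_of_isNilpotent
      ((Commute.all x y).isNilpotent_mul_right hx)).eq_zero
  · intro h
    have : IsArtinianRing A := IsArtinianRing.of_finite ℂ A
    -- Stabilization of the powers of x gives x^k = x^(k+1) y. Then (xy)^(k+1) is idempotent and a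
    -- multiple of x, so its trace vanishes; in characteristic 0 an idempotent of trace 0 is 0.
    obtain ⟨k, y, hy⟩ := IsArtinian.exists_pow_succ_smul_dvd x (1 : A)
    simp only [smul_eq_mul, mul_one, Nat.succ_eq_add_one] at hy
    have h1 : ∀ j, x ^ (k + 1) = x ^ (k + 1) * (x * y) ^ j := by
      intro j
      induction j with
      | zero => simp
      | succ j ih =>
        rw [pow_succ (x * y) j, ← mul_assoc, ← ih]
        linear_combination -x * hy
    have h2 := h1 (k + 1)
    have he : IsIdempotentElem ((x * y) ^ (k + 1)) := by
      change _ * _ = _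
      conv_rhs => rw [mul_pow, h2]
      ring
    have h3 : Algebra.trace ℂ A ((x * y) ^ (k + 1)) = 0 := by
      rw [pow_succ', mul_assoc]
      exact h _
    have h4 : IsIdempotentElem (Algebra.lmul ℂ A ((x * y) ^ (k + 1))) := he.map _
    have h5 := LinearMap.IsIdempotentElem.eq_zero_of_trace_eq_zero h4 h3
    have h6 : (x * y) ^ (k + 1) = 0 := by
      simpa using congrArg (fun f => f 1) h5
    exact ⟨k + 1, by rw [h2, h6, mul_zero]⟩


lemma exists_quotientBasis {B : Finset (Mon n)} {J : Ideal (Poly n)}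
    (h : IsCompl (mspan (B : Set (Mon n))) (J.restrictScalars ℂ)) :
    ∃ β : Module.Basis B ℂ (Poly n ⧸ J), ∀ b, β b = Ideal.Quotient.mkₐ ℂ J (monomial b.1 1) := by
  refine ⟨Module.Basis.mk (v := fun b : B => Ideal.Quotient.mkₐ ℂ J (monomial b.1 1))
    (linearIndependent_mk_monomial h.1) ?_, fun b => by simp⟩
  intro x _
  obtain ⟨p, rfl⟩ := Ideal.Quotient.mkₐ_surjective ℂ J x
  obtain ⟨q, hq, r, hr, rfl⟩ := Submodule.mem_sup.1 (h.sup_eq_top ▸ Submodule.mem_top (x := p))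
  have h1 : Ideal.Quotient.mkₐ ℂ J r = 0 := Ideal.Quotient.eq_zero_iff_mem.2 hr
  rw [map_add, h1, add_zero, eq_sum_support q, map_sum]
  refine sum_mem fun b hb => ?_
  rw [map_smul]
  exact Submodule.smul_mem _ _ (Submodule.subset_span ⟨⟨b, hq hb⟩, rfl⟩)

lemma exists_socleFamily {B : Finset (Mon n)} {G : Finset (Poly n)} {Λ : Poly n →ₗ[ℂ] ℂ}
    (h0 : (0 : Mon n) ∈ B)
    (hG : ∀ m ∈ border (B : Set (Mon n)), ∃ g ∈ G, IsLead (B : Set (Mon n)) g m)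
    (hdet : IsUnit (hankel Λ B).det) : ∃ F', SocleFamily B G Λ F' := by
  classical
  have hρ : ∀ i j : B, ∃ q ∈ mspan (B : Set (Mon n)), Reduces (B : Set (Mon n)) (G : Set (Poly n))
      (socleDelta B Λ * monomial i.1 1 * monomial j.1 1) q := fun i j =>
    exists_reduces_mem_mspan h0 hG _
  choose ρ hρB hρ using hρ
  obtain ⟨G', hG'⟩ : (kerPoly (Matrix.of fun i j => Λ (ρ i j))).FG :=
    Submodule.FG.map _ (Module.Finite.iff_fg.1 inferInstance)
  exact ⟨G' ∪ G, hdet, ρ, fun i j => ⟨hρ i j, hρB i j⟩, G', hG', by simp⟩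

/-- The socle step computes generators of the radical. -/
theorem span_socleFamily {B : Finset (Mon n)} {G : Finset (Poly n)} {Λ : Poly n →ₗ[ℂ] ℂ}
    {F' : Finset (Poly n)}
    (hcompl : IsCompl (mspan (B : Set (Mon n))) ((Ideal.span (G : Set (Poly n))).restrictScalars ℂ))
    (h0 : (0 : Mon n) ∈ B)
    (hG : ∀ m ∈ border (B : Set (Mon n)), ∃ g ∈ G, IsLead (B : Set (Mon n)) g m)
    (hgr : ∀ g ∈ (G : Set (Poly n)), ∀ m, IsLead (B : Set (Mon n)) g m → m.degree = g.totalDegree)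
    (hΛ : ∀ κ ∈ redFamily (B : Set (Mon n)) (G : Set (Poly n)) (B : Set (Mon n)), Λ κ = 0)
    (hF' : SocleFamily B G Λ F') :
    Ideal.span (F' : Set (Poly n)) = (Ideal.span (G : Set (Poly n))).radical := by
  classical
  obtain ⟨hdet, ρ, hρ, G', hG', hF'⟩ := hF'
  set J := Ideal.span (G : Set (Poly n)) with hJ
  let mk := Ideal.Quotient.mkₐ ℂ J
  have mk_eq : ∀ p q : Poly n, p - q ∈ J → mk p = mk q := fun p q h => Ideal.Quotient.eq.2 h
  obtain ⟨β, hβ⟩ := exists_quotientBasis hcompl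
  have hfinA : Module.Finite ℂ (Poly n ⧸ J) := Module.Finite.of_basis β
  let L : (Poly n ⧸ J) →ₗ[ℂ] ℂ := β.constr ℂ fun b => Λ (monomial b.1 1)
  have hL : ∀ p ∈ mspan (B : Set (Mon n)), L (mk p) = Λ p := by
    have : mspan (B : Set (Mon n)) ≤ LinearMap.eqLocus (L.comp mk.toLinearMap) Λ := by
      rw [mspan_le_iff]
      intro m hm
      have h1 : mk (monomial m 1) = β ⟨m, hm⟩ := (hβ ⟨m, hm⟩).symm
      have h2 : L (β ⟨m, hm⟩) = Λ (monomial m 1) := β.constr_basis ℂ _ _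
      change L (mk (monomial m 1)) = Λ (monomial m 1)
      rw [h1, h2]
    exact fun p hp => this hp
  have hH : ∀ i j : B, hankel Λ B i j = L (β i * β j) := by
    intro i j
    obtain ⟨p, hp, hpp⟩ := exists_projectsTo (G := (G : Set (Poly n))) h0 hG (i.1 + j.1)
    -- As 1 ∈ B, the projection into ⟨B⟩ also lies in ⟨B · B⟩, which is what makes the relation one
    -- that Λ annihilates.
    have hsub : (B : Set (Mon n)) ⊆ prodSet (B : Set (Mon n)) := fun b hb =>
      ⟨b, hb, 0, h0, (add_zero b).symm⟩
    have h1 := hΛ _ ⟨i.1 + j.1, ⟨i.1, i.2, j.1, j.2, rfl⟩, p, hpp, mspan_mono hsub hp, rfl⟩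
    rw [map_sub, sub_eq_zero] at h1
    rw [hβ, hβ, ← map_mul, monomial_mul, one_mul]
    change Λ _ = L (mk _)
    rw [h1, mk_eq _ _ hpp.sub_mem, hL p hp]
  -- The basis dual to β for the pairing (a, b) ↦ L(ab), so that x ↦ L(e_i x) is the i-th
  -- coordinate.
  let e : B → Poly n ⧸ J := fun i => ∑ j : B, (hankel Λ B)⁻¹ i j • β j
  have he : ∀ i x, L (e i * x) = β.repr x i := by
    intro i x
    suffices h : L.comp (LinearMap.mulLeft ℂ (e i)) = β.coord i from
      LinearMap.congr_fun h x
    refine β.ext fun k => ?_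
    have h1 := congrFun (congrFun (Matrix.nonsing_inv_mul (hankel Λ B) hdet) i) k
    rw [Matrix.mul_apply] at h1
    simp only [LinearMap.comp_apply, LinearMap.mulLeft_apply, e, Finset.sum_mul, map_sum,
      smul_mul_assoc, map_smul, smul_eq_mul, ← hH, h1, Module.Basis.coord_apply,
      Module.Basis.repr_self, Matrix.one_apply, Finsupp.single_apply, eq_comm]
  -- Since Δ = ∑ β_i e_i, L(Δa) sums the i-th coordinates of aβ_i: the diagonal of multiplication by
  -- a.
  have hΔ : ∀ a, L (mk (socleDelta B Λ) * a) = Algebra.trace ℂ (Poly n ⧸ J) a := by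
    intro a
    have h1 : mk (socleDelta B Λ) = ∑ i : B, β i * e i := by
      simp only [socleDelta, map_sum, map_mul, map_smul, e, hβ, mk]
    rw [h1, Algebra.trace_eq_matrix_trace β, Matrix.trace, Finset.sum_mul, map_sum]
    refine Finset.sum_congr rfl fun i _ => ?_
    rw [Matrix.diag_apply, Algebra.leftMulMatrix_eq_repr_mul, ← he]
    congr 1
    ring
  have hM : ∀ i j : B, Λ (ρ i j) = Algebra.trace ℂ (Poly n ⧸ J) (β i * β j) := by
    intro i j
    rw [← hL _ (hρ i j).2, ← hΔ, ← mk_eq _ _ ((hρ i j).1.sub_mem hgr), map_mul mk, map_mul mk, hβ,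
      hβ, mul_assoc]
  have hker : ∀ p, p ∈ kerPoly (Matrix.of fun i j => Λ (ρ i j)) ↔
      p ∈ mspan (B : Set (Mon n)) ∧ p ∈ J.radical := by
    have key : ∀ u : B → ℂ, (Matrix.of fun i j => Λ (ρ i j)).mulVec u = 0 ↔
        ∑ m : B, u m • (monomial m.1 1 : Poly n) ∈ J.radical := by
      intro u
      have h1 : mk (∑ m : B, u m • (monomial m.1 1 : Poly n)) = ∑ m : B, u m • β m := by
        simp only [map_sum, map_smul, hβ, mk]
      have h2 : ∑ m : B, u m • (monomial m.1 1 : Poly n) ∈ J.radical ↔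
          IsNilpotent (∑ m : B, u m • β m) := by
        rw [← h1]
        refine exists_congr fun k => ?_
        rw [← map_pow]
        exact Ideal.Quotient.eq_zero_iff_mem.symm
      rw [h2, isNilpotent_iff_trace_mul_eq_zero]
      have h3 : ∀ i, (Matrix.of fun i j => Λ (ρ i j)).mulVec u i =
          Algebra.trace ℂ (Poly n ⧸ J) ((∑ m : B, u m • β m) * β i) := by
        intro i
        simp only [Matrix.mulVec, dotProduct, Matrix.of_apply, hM, Finset.sum_mul, map_sum,
          smul_mul_assoc, map_smul, smul_eq_mul]
        exact Finset.sum_congr rfl fun j _ => by rw [mul_comm (β j), mul_comm (u j)]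
      constructor
      · intro h y
        suffices h' : (Algebra.trace ℂ (Poly n ⧸ J)).comp
            (LinearMap.mulLeft ℂ (∑ m : B, u m • β m)) = 0 from LinearMap.congr_fun h' y
        refine β.ext fun i => ?_
        rw [LinearMap.comp_apply, LinearMap.mulLeft_apply, ← h3, h]
        rfl
      · intro h
        funext i
        rw [h3, h]
        rfl
    intro p
    rw [mem_kerPoly]
    constructor
    · rintro ⟨u, hu, rfl⟩
      exact ⟨sum_mem fun m _ => Submodule.smul_mem _ _ (monomial_mem_mspan m.2 1), (key u).1 hu⟩
    · rintro ⟨hp, hpr⟩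
      have h1 : ∑ m : B, coeff m.1 p • (monomial m.1 1 : Poly n) = p := by
        conv_rhs => rw [eq_sum_support p]
        rw [Finset.sum_coe_sort B fun m => coeff m p • (monomial m 1 : Poly n)]
        refine (Finset.sum_subset (mem_mspan.1 hp) fun m _ hm => ?_).symm
        rw [notMem_support_iff.1 hm, zero_smul]
      exact ⟨fun m => coeff m.1 p, (key _).2 (by rwa [h1]), h1⟩
  rw [hF']
  apply le_antisymm
  · rw [Ideal.span_le]
    rintro p (hp | hp)
    · exact ((hker p).1 (hG' ▸ Submodule.subset_span hp)).2
    · exact Ideal.le_radical (Ideal.subset_span hp)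
  · intro p hp
    obtain ⟨q, hq, r, hr, rfl⟩ :=
      Submodule.mem_sup.1 (hcompl.sup_eq_top ▸ Submodule.mem_top (x := p))
    have hrJ : r ∈ J := hr
    have hqr : q ∈ J.radical := by
      simpa using sub_mem hp (Ideal.le_radical hrJ)
    refine add_mem ?_ (Ideal.span_mono Set.subset_union_right hrJ)
    have h1 : q ∈ Submodule.span ℂ (G' : Set (Poly n)) := hG' ▸ (hker q).2 ⟨hq, hqr⟩
    have h2 : Submodule.span ℂ (G' : Set (Poly n)) ≤
        (Ideal.span ((G' : Set (Poly n)) ∪ G)).restrictScalars ℂ :=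
      Submodule.span_le.2 fun g hg => Ideal.subset_span (Or.inl hg)
    exact h2 h1

/-! ### One pass through the loop -/

/-- The invariants of the loop, for input whose relations lie in the ideal `J`. -/
structure LoopInvariant (J : Ideal (Poly n)) (s : State n) : Prop where
  connected : ConnectedToOne (s.B : Set (Mon n))
  degree_le : ∀ m ∈ s.B, m.degree ≤ s.t
  complete : IsCompleteInDegree (s.B : Set (Mon n)) (s.G : Set (Poly n)) s.t
  totalDegree_le : ∀ g ∈ s.G, g.totalDegree ≤ s.t
  mem_ideal : ∀ g ∈ s.G, g ∈ J

/-- Sets of relations that may be added in one pass. -/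
structure IsRelationSet (J : Ideal (Poly n)) (s : State n) (P : Set (Poly n)) : Prop where
  mem_mspan : ∀ p ∈ P, p ∈ mspan (upTo (prolong (s.B : Set (Mon n))) (s.t + 1))
  mem_of_le : ∀ p ∈ P, p.totalDegree ≤ s.t → p ∈ mspan (s.B : Set (Mon n))
  mem_ideal : ∀ p ∈ P, p ∈ J

lemma loopInvariant_initState (J : Ideal (Poly n)) : LoopInvariant J (initState n) where
  connected := by
    refine ⟨by simp [initState], fun m hm h => absurd ?_ h⟩
    simpa [initState] using hm
  degree_le := by simp [initState]
  complete := by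
    refine ⟨⟨by simp [initState], by simp [initState]⟩, by simp [initState], fun m hm hd => ?_⟩
    refine absurd ?_ hm.2
    simpa [initState, Finsupp.degree_eq_zero_iff] using hd
  totalDegree_le := by simp [initState]
  mem_ideal := by simp [initState]

lemma exists_isLeastDegree (P : Set (Poly n)) (d₀ : ℕ) : ∃ d, IsLeastDegree P d₀ d := by
  classical
  by_cases h : ∃ d, ∃ p ∈ P, p ≠ 0 ∧ p.totalDegree = d
  · obtain ⟨p, hp, hp0, hpd⟩ := Nat.find_spec h
    exact ⟨_, Or.inl ⟨p, hp, hp0, hpd, fun q hq hq0 => Nat.find_min' h ⟨q, hq, hq0, rfl⟩⟩⟩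
  · refine ⟨d₀, Or.inr ⟨fun p hp => ?_, rfl⟩⟩
    by_contra hp0
    exact h ⟨_, p, hp, hp0, rfl⟩

lemma IsLeastDegree.le_totalDegree {P : Set (Poly n)} {d₀ d : ℕ} (h : IsLeastDegree P d₀ d)
    {p : Poly n} (hp : p ∈ P) (hp0 : p ≠ 0) : d ≤ p.totalDegree := by
  rcases h with ⟨q, -, -, -, h⟩ | ⟨h, -⟩
  · exact h p hp hp0
  · exact absurd (h p hp) hp0

lemma IsLeastDegree.le {P : Set (Poly n)} {d₀ d : ℕ} (h : IsLeastDegree P d₀ d)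
    (hP : ∀ p ∈ P, p.totalDegree ≤ d₀) : d ≤ d₀ := by
  rcases h with ⟨q, hq, -, h, -⟩ | ⟨-, h⟩
  · exact h ▸ hP q hq
  · exact h.le

lemma one_le_totalDegree {J : Ideal (Poly n)} (hJ : J ≠ ⊤) {p : Poly n} (hp : p ∈ J)
    (hp0 : p ≠ 0) : 1 ≤ p.totalDegree := by
  by_contra h
  have h0 : p.totalDegree = 0 := by omega
  rw [totalDegree_eq_zero_iff_eq_C] at h0
  have hc : coeff 0 p ≠ 0 := by
    intro hc
    rw [hc, C_0] at h0
    exact hp0 h0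
  refine hJ (J.eq_top_of_isUnit_mem hp ?_)
  rw [h0]
  exact (isUnit_iff_ne_zero.2 hc).map C

/-- A set of monomials can be extended to a basis of a space of polynomials modulo a subspace. -/
lemma exists_monomial_complement {A₀ A : Set (Mon n)} (hA : A₀ ⊆ A) {U : Submodule ℂ (Poly n)}
    (h : Disjoint (mspan A₀) U) : ∃ A', A₀ ⊆ A' ∧ A' ⊆ A ∧ Disjoint (mspan A') U ∧
      mspan A ≤ mspan A' ⊔ U := by
  let v : Mon n → Poly n ⧸ U := fun m => U.mkQ (monomial m 1)
  have hspan : ∀ C : Set (Mon n), Submodule.span ℂ ((fun m => (monomial m 1 : Poly n)) '' C) =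
      mspan C := fun C => (restrictSupport_eq_span ℂ C).symm
  have hv : LinearIndepOn ℂ v A₀ := by
    rw [linearIndepOn_iff']
    intro t c ht hc m hm
    have h1 : U.mkQ (∑ m ∈ t, c m • (monomial m 1 : Poly n)) = 0 := by
      simpa only [map_sum, map_smul] using hc
    rw [Submodule.mkQ_apply, Submodule.Quotient.mk_eq_zero] at h1
    have h2 := Submodule.disjoint_def.1 h _ (sum_mem fun m hm =>
      Submodule.smul_mem _ _ (monomial_mem_mspan (ht hm) 1)) h1
    have h3 := congrArg (coeff m) h2
    simpa [coeff_sum, coeff_monomial, Finset.sum_ite_eq, hm] using h3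
  obtain ⟨A', h1, h2, h3, h4⟩ := exists_linearIndepOn_extension hv hA
  have hspanv : ∀ C : Set (Mon n), Submodule.span ℂ (v '' C) = (mspan C).map U.mkQ := by
    intro C
    rw [← hspan, Submodule.map_span, Set.image_image]
  refine ⟨A', h2, h1, ?_, ?_⟩
  · rw [Submodule.disjoint_def]
    intro p hp hpU
    have h5 : ∑ m ∈ p.support, coeff m p • v m = 0 := by
      have h6 : U.mkQ p = 0 := (Submodule.Quotient.mk_eq_zero U).2 hpU
      rw [eq_sum_support p] at h6
      simpa only [map_sum, map_smul] using h6
    ext m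
    by_cases hm : m ∈ p.support
    · exact linearIndepOn_iff'.1 h4 _ _ hp h5 m hm
    · exact notMem_support_iff.1 hm
  · rw [← Submodule.span_le, hspanv, hspanv, Submodule.map_le_iff_le_comap,
      Submodule.comap_map_mkQ] at h3
    rwa [sup_comm]

/-! ### New monomial sets and new rewriting families -/

section Pass

variable {J : Ideal (Poly n)} {s : State n} {P : Set (Poly n)} {d : ℕ}

lemma newRelations_le_ideal (hs : LoopInvariant J s) (hP : IsRelationSet J s P) :
    ∀ p ∈ newRelations s P d, p ∈ J := by
  intro p hp
  have h : Submodule.span ℂ (polyProlong (s.G : Set (Poly n)) ∪ P) ≤ J.restrictScalars ℂ := by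
    rw [Submodule.span_le]
    rintro q ((hq | ⟨i, g, hg, rfl⟩) | hq)
    · exact hs.mem_ideal q hq
    · exact J.mul_mem_left _ (hs.mem_ideal g hg)
    · exact hP.mem_ideal q hq
  exact h hp.1

lemma newRelations_le : newRelations s P d ≤ mspan (upTo (prolong (s.B : Set (Mon n))) d) :=
  inf_le_right

lemma LoopInvariant.exists_lead (hs : LoopInvariant J s) {m : Mon n}
    (hm : m ∈ border (s.B : Set (Mon n))) (hmt : m.degree ≤ s.t) :
    ∃ g ∈ s.G, IsLead (s.B : Set (Mon n)) g m ∧ g.totalDegree = m.degree := by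
  obtain ⟨g, hg, hl⟩ := hs.complete.2.2 m hm hmt
  exact ⟨g, hg, hl, (hs.complete.2.1 g hg m hl).symm⟩

lemma mem_newRelations_of_mem (hs : LoopInvariant J s) {g : Poly n} (hg : g ∈ s.G)
    (hgd : g.totalDegree ≤ d) : g ∈ newRelations s P d := by
  obtain ⟨m, hl⟩ := hs.complete.1.1 g hg
  exact ⟨Submodule.subset_span (Or.inl (Or.inl hg)),
    mem_mspan_upTo.2 ⟨hl.mem_mspan_prolong, hgd⟩⟩

lemma IsLead.sub_mem_upTo {B : Set (Mon n)} {g : Poly n} {m : Mon n} {k : ℕ} (hl : IsLead B g m)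
    (hg : g.totalDegree ≤ k) : monomial m 1 - g ∈ mspan (upTo B k) := by
  refine mem_mspan_upTo.2 ⟨hl.sub_mem, (totalDegree_sub _ _).trans (max_le ?_ hg)⟩
  rw [totalDegree_monomial_one]
  exact (degree_le_of_mem_support hl.mem_support).trans hg

lemma IsRelationSet.least_le (hP : IsRelationSet J s P) (hd : IsLeastDegree P (s.t + 1) d) :
    d ≤ s.t + 1 :=
  hd.le fun p hp => (mem_mspan_upTo.1 (hP.mem_mspan p hp)).2

lemma IsRelationSet.one_le (hP : IsRelationSet J s P) (hd : IsLeastDegree P (s.t + 1) d)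
    (hJ : J ≠ ⊤) : 1 ≤ d := by
  rcases hd with ⟨p, hp, hp0, rfl, -⟩ | ⟨-, rfl⟩
  · exact one_le_totalDegree hJ (hP.mem_ideal p hp) hp0
  · omega

/-- If the new relations do not meet `⟨B⟩`, then `d = t + 1`. -/
lemma least_eq_of_disjoint (hP : IsRelationSet J s P) (hd : IsLeastDegree P (s.t + 1) d)
    (hW : ∀ w ∈ newRelations s P d, w ∈ mspan (s.B : Set (Mon n)) → w = 0) : d = s.t + 1 := by
  rcases hd with ⟨p, hp, hp0, hpd, -⟩ | ⟨-, rfl⟩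
  · by_contra hne
    have hle : d ≤ s.t + 1 := hpd ▸ (mem_mspan_upTo.1 (hP.mem_mspan p hp)).2
    refine hp0 (hW p ⟨Submodule.subset_span (Or.inr hp), mem_mspan_upTo.2
      ⟨(mem_mspan_upTo.1 (hP.mem_mspan p hp)).1, hpd.le⟩⟩ (hP.mem_of_le p hp (by omega)))
  · rfl

/-- The least degree of a new relation in `⟨B⟩` admits a new monomial set. -/
theorem exists_isNewBasis (hs : LoopInvariant J s) (hd : d ≤ s.t + 1)
    {e : ℕ} (he1 : 1 ≤ e) (hed : e ≤ d)
    (hW : ∀ w ∈ newRelations s P d, w ∈ mspan (s.B : Set (Mon n)) → w ≠ 0 → e ≤ w.totalDegree) :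
    ∃ B', IsNewBasis s.B (newRelations s P d) e B' := by
  set W := newRelations s P d with hWdef
  -- B below degree e is independent modulo W by the choice of e, and is kept. It is extended only
  -- inside B or by monomials of degree t + 1: border monomials of degree at most t are already
  -- rewritten by G.
  let A₀ : Set (Mon n) := {m | m ∈ s.B ∧ m.degree < e}
  let A : Set (Mon n) := {m | m ∈ upTo (prolong (s.B : Set (Mon n))) e ∧
    (m ∈ s.B ∨ m.degree = s.t + 1)}
  have hA₀A : A₀ ⊆ A := fun m hm => ⟨⟨subset_prolong _ hm.1, hm.2.le⟩, Or.inl hm.1⟩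
  have hdis : Disjoint (mspan A₀) W := by
    rw [Submodule.disjoint_def]
    intro p hp hpW
    by_contra hp0
    have h1 := hW p hpW (mspan_mono (fun m hm => hm.1) hp) hp0
    have h2 : p.totalDegree ≤ e - 1 :=
      totalDegree_le_iff.2 fun m hm => Nat.le_sub_one_of_lt (hp hm).2
    omega
  obtain ⟨A', h1, h2, h3, h4⟩ := exists_monomial_complement hA₀A hdis
  have hfin : A'.Finite := (Finsupp.finite_of_degree_le e).subset fun m hm => (h2 hm).1.2
  have hA'e : ∀ m ∈ A', m.degree ≤ e := fun m hm => (h2 hm).1.2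
  have hA'deg : ∀ a ∈ mspan A', a.totalDegree ≤ e := fun a ha =>
    totalDegree_le_iff.2 fun m hm => hA'e m (ha hm)
  -- the decomposition of a monomial of degree `e`
  have htop : ∀ m ∈ A, ∃ a ∈ mspan A', ∃ w ∈ W, a + w = monomial m 1 ∧ w.totalDegree ≤ e := by
    intro m hm
    obtain ⟨a, ha, w, hw, haw⟩ := Submodule.mem_sup.1 (h4 (monomial_mem_mspan hm 1))
    refine ⟨a, ha, w, hw, haw, ?_⟩
    rw [← sub_eq_iff_eq_add'.2 haw.symm]
    refine (totalDegree_sub _ _).trans (max_le ?_ (hA'deg a ha))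
    rw [totalDegree_monomial_one]
    exact hm.1.2
  have hB : ∀ k ≤ e, mspan (upTo (s.B : Set (Mon n)) k) ≤
      mspan (upTo A' k) ⊔ (W ⊓ restrictTotalDegree (Fin n) ℂ k) := by
    intro k hk
    rw [mspan_le_iff]
    rintro m ⟨hmB, hmk⟩
    by_cases hme : m.degree < e
    · exact Submodule.mem_sup_left (monomial_mem_mspan
        (show m ∈ upTo A' k from ⟨h1 ⟨hmB, hme⟩, hmk⟩) 1)
    · obtain rfl : k = e := by omega
      obtain ⟨a, ha, w, hw, haw, hwe⟩ := htop m ⟨⟨subset_prolong _ hmB, hmk⟩, Or.inl hmB⟩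
      rw [← haw]
      exact Submodule.add_mem_sup (mem_mspan_upTo.2 ⟨ha, hA'deg a ha⟩)
        ⟨hw, (mem_restrictTotalDegree _ _ _).2 hwe⟩
  refine ⟨hfin.toFinset, ⟨?_, ?_⟩, ?_, ?_, ?_⟩
  · rw [Set.Finite.coe_toFinset]
    exact h1 ⟨hs.connected.1, by simpa using Nat.lt_of_lt_of_le Nat.zero_lt_one he1⟩
  · rw [Set.Finite.coe_toFinset]
    intro m hm hm0
    -- In either case m has a predecessor in B of degree below e, and that part of B was kept.
    by_cases hmB : m ∈ (s.B : Set (Mon n))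
    · obtain ⟨i, m', hm', rfl⟩ := hs.connected.2 m hmB hm0
      refine ⟨i, m', h1 ⟨hm', ?_⟩, rfl⟩
      have := hA'e _ hm
      rw [map_add, Finsupp.degree_single] at this
      omega
    · obtain ⟨i, m', hm', rfl⟩ := (h2 hm).1.1.resolve_left hmB
      refine ⟨i, m', h1 ⟨hm', ?_⟩, rfl⟩
      have := hA'e _ hm
      rw [map_add, Finsupp.degree_single] at this
      omega
  · rw [Set.Finite.coe_toFinset]
    exact fun m hm => (h2 hm).1
  · rw [Set.Finite.coe_toFinset]
    intro k hk
    refine ⟨h3.mono (mspan_mono fun m hm => hm.1) inf_le_left, le_antisymm (sup_le ?_ ?_) ?_⟩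
    · exact mspan_mono fun m hm => ⟨(h2 hm.1).1.1, hm.2⟩
    · rintro p ⟨hpW, hpk⟩
      exact mem_mspan_upTo.2 ⟨(mem_mspan_upTo.1 (newRelations_le hpW)).1,
        (mem_restrictTotalDegree _ _ _).1 hpk⟩
    · rw [mspan_le_iff]
      rintro m ⟨hm, hmk⟩
      by_cases hmB : m ∈ (s.B : Set (Mon n))
      · exact hB k hk (monomial_mem_mspan (show m ∈ upTo (s.B : Set (Mon n)) k from ⟨hmB, hmk⟩) 1)
      by_cases hmt : m.degree ≤ s.t
      · obtain ⟨g, hg, hl, hgd⟩ := hs.exists_lead ⟨hm, hmB⟩ hmt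
        rw [← sub_add_cancel (monomial m 1) g]
        refine add_mem (hB k hk (hl.sub_mem_upTo (hgd.le.trans hmk))) (Submodule.mem_sup_right
          ⟨mem_newRelations_of_mem hs hg (by omega), (mem_restrictTotalDegree _ _ _).2 (by omega)⟩)
      · obtain rfl : k = e := by omega
        obtain ⟨a, ha, w, hw, haw, hwe⟩ := htop m ⟨⟨hm, hmk⟩, Or.inr (by omega)⟩
        rw [← haw]
        exact Submodule.add_mem_sup (mem_mspan_upTo.2 ⟨ha, hA'deg a ha⟩)
          ⟨hw, (mem_restrictTotalDegree _ _ _).2 hwe⟩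
  · rw [Set.Finite.coe_toFinset]
    intro k hk
    refine le_antisymm (sup_le (mspan_mono fun m hm => ⟨hm.1.1, hm.2⟩) inf_le_right) ?_
    rw [mspan_le_iff]
    rintro m ⟨hmB, hmk⟩
    by_cases hme : m.degree < e
    · exact Submodule.mem_sup_left (monomial_mem_mspan
        (show m ∈ upTo ((s.B : Set (Mon n)) ∩ A') k from
          ⟨⟨hmB, h1 ⟨hmB, hme⟩⟩, hmk⟩) 1)
    · obtain rfl : k = e := by omega
      have hkt : k ≤ s.t := by
        have := hs.degree_le m hmB
        omega
      -- Here e ≤ t, so the alternative of degree t + 1 in A is empty.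
      have hAB : A' ⊆ s.B := fun b hb => (h2 hb).2.resolve_right (by
        have := hA'e b hb
        omega)
      obtain ⟨a, ha, w, hw, haw, hwe⟩ := htop m ⟨⟨subset_prolong _ hmB, hmk⟩, Or.inl hmB⟩
      have haB : a ∈ mspan (upTo ((s.B : Set (Mon n)) ∩ A') k) :=
        mem_mspan_upTo.2 ⟨fun b hb => ⟨hAB (ha hb), ha hb⟩, hA'deg a ha⟩
      rw [← haw]
      refine Submodule.add_mem_sup haB ⟨hw, ?_⟩
      rw [← sub_eq_iff_eq_add'.2 haw.symm]
      exact sub_mem (monomial_mem_mspan (show m ∈ upTo (s.B : Set (Mon n)) k from ⟨hmB, hmk⟩) 1)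
        (mspan_mono (show upTo ((s.B : Set (Mon n)) ∩ A') k ⊆ upTo s.B k from
          fun b hb => ⟨hb.1.1, hb.2⟩) haB)

variable {e : ℕ} {B' : Finset (Mon n)} {G' : Finset (Poly n)}

lemma IsNewBasis.eq_zero_of_mem {B : Finset (Mon n)} {W : Submodule ℂ (Poly n)}
    (hB' : IsNewBasis B W e B') {p : Poly n} (hpW : p ∈ W)
    (hpB : p ∈ mspan (B' : Set (Mon n))) (hpe : p.totalDegree ≤ e) : p = 0 :=
  Submodule.disjoint_def.1 (hB'.2.2.1 e le_rfl).1 p (mem_mspan_upTo.2 ⟨hpB, hpe⟩)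
    ⟨hpW, (mem_restrictTotalDegree _ _ _).2 hpe⟩

lemma IsNewBasis.degree_le {B : Finset (Mon n)} {W : Submodule ℂ (Poly n)}
    (hB' : IsNewBasis B W e B') {m : Mon n} (hm : m ∈ B') : m.degree ≤ e :=
  (hB'.2.1 hm).2

/-- New monomials appear only in degree `t + 1`. -/
lemma IsNewBasis.mem_of_degree_le (hs : LoopInvariant J s) (hed : e ≤ d)
    (hB' : IsNewBasis s.B (newRelations s P d) e B') {m : Mon n} (hm : m ∈ B')
    (hmt : m.degree ≤ s.t) : m ∈ s.B := by
  by_contra hmB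
  have hme := hB'.degree_le hm
  obtain ⟨g, hg, hl, hgd⟩ := hs.exists_lead ⟨(hB'.2.1 hm).1, hmB⟩ hmt
  have h1 : monomial m 1 - g ∈ mspan (upTo (s.B : Set (Mon n)) e) :=
    hl.sub_mem_upTo (by omega)
  -- The clause that B loses only leading monomials of relations in ⟨B⟩ rewrites m − g as u + w with
  -- u ∈ ⟨B ∩ B'⟩ and w ∈ W. Then m − u lies in W ∩ ⟨B'⟩ = 0, which forces m ∈ B.
  rw [← hB'.2.2.2 e le_rfl] at h1
  obtain ⟨u, hu, w, hw, huw⟩ := Submodule.mem_sup.1 h1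
  have h2 : monomial m 1 - u = w + g := by
    rw [sub_eq_iff_eq_add, add_assoc, add_comm g u, ← add_assoc, add_comm w u, huw,
      sub_add_cancel]
  have hu' := mem_mspan_upTo.1 hu
  have h3 : (monomial m 1 - u : Poly n) = 0 := by
    refine hB'.eq_zero_of_mem ?_ (sub_mem (monomial_mem_mspan hm 1)
      (mspan_mono Set.inter_subset_right hu'.1)) ?_
    · rw [h2]
      exact add_mem hw.1 (mem_newRelations_of_mem hs hg (by omega))
    · refine (totalDegree_sub _ _).trans (max_le ?_ hu'.2)
      rwa [totalDegree_monomial_one]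
  rw [sub_eq_zero] at h3
  exact hmB (monomial_one_mem_mspan_iff.1 (h3 ▸ mspan_mono Set.inter_subset_left hu'.1))

lemma IsNewBasis.mem_prolong (hs : LoopInvariant J s) (hd : d ≤ s.t + 1) (hed : e ≤ d)
    (hB' : IsNewBasis s.B (newRelations s P d) e B') {m : Mon n}
    (hm : m ∈ prolong (B' : Set (Mon n))) (hme : m.degree ≤ e) :
    m ∈ prolong (s.B : Set (Mon n)) := by
  rcases hm with hm | ⟨i, b, hb, rfl⟩
  · exact (hB'.2.1 hm).1
  · rw [map_add, Finsupp.degree_single] at hme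
    exact single_add_mem_prolong (hB'.mem_of_degree_le hs hed hb (by omega)) i

lemma IsNewBasis.eq_of_isLead {B : Finset (Mon n)} {W : Submodule ℂ (Poly n)}
    (hB' : IsNewBasis B W e B') {g g' : Poly n} (hg : g ∈ W) (hg' : g' ∈ W)
    (hge : g.totalDegree ≤ e) (hge' : g'.totalDegree ≤ e) {m : Mon n}
    (hl : IsLead (B' : Set (Mon n)) g m) (hl' : IsLead (B' : Set (Mon n)) g' m) : g = g' := by
  rw [← sub_eq_zero]
  refine hB'.eq_zero_of_mem (sub_mem hg hg') ?_ ((totalDegree_sub _ _).trans (max_le hge hge'))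
  have := sub_mem hl'.sub_mem hl.sub_mem
  rwa [sub_sub_sub_cancel_left] at this

/-- Splitting a border monomial m of B' along ⟨B'⟩ ⊕ W in degree exactly deg m, rather than e, makes
the W-component graded with leading monomial m. -/
theorem IsNewBasis.exists_isNewFamily (hs : LoopInvariant J s) (hd : d ≤ s.t + 1) (hed : e ≤ d)
    (hB' : IsNewBasis s.B (newRelations s P d) e B') :
    ∃ G', IsNewFamily B' (newRelations s P d) e G' := by
  classical
  set W := newRelations s P d
  let C : Set (Mon n) := upTo (border (B' : Set (Mon n))) e
  have hC : C.Finite := (Finsupp.finite_of_degree_le e).subset fun m hm => hm.2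
  have hex : ∀ m : Mon n, ∃ g : Poly n, m ∈ C → g ∈ W ∧ IsLead (B' : Set (Mon n)) g m ∧
      g.totalDegree = m.degree := by
    intro m
    by_cases hm : m ∈ C
    · have hmp := hB'.mem_prolong hs hd hed hm.1.1 hm.2
      have h1 := (hB'.2.2.1 m.degree hm.2).2
      have h2 : (monomial m 1 : Poly n) ∈ mspan (upTo (prolong (s.B : Set (Mon n))) m.degree) :=
        monomial_mem_mspan
          (show m ∈ upTo (prolong (s.B : Set (Mon n))) m.degree from ⟨hmp, le_rfl⟩) 1
      rw [← h1] at h2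
      obtain ⟨u, hu, w, hw, huw⟩ := Submodule.mem_sup.1 h2
      have hl : IsLead (B' : Set (Mon n)) w m := by
        refine .of_sub_mem hm.1 ?_
        rw [← huw, add_sub_cancel_right]
        exact (mem_mspan_upTo.1 hu).1
      exact ⟨w, fun _ => ⟨hw.1, hl, le_antisymm ((mem_restrictTotalDegree _ _ _).1 hw.2)
        (degree_le_of_mem_support hl.mem_support)⟩⟩
    · exact ⟨0, fun h => absurd h hm⟩
  choose γ hγ using hex
  refine ⟨hC.toFinset.image γ, ⟨⟨?_, ?_⟩, ?_, ?_⟩, ?_⟩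
  · intro g hg
    obtain ⟨m, hm, rfl⟩ := Finset.mem_image.1 hg
    exact ⟨m, (hγ m (hC.mem_toFinset.1 hm)).2.1⟩
  · intro g hg g' hg' l hl hl'
    obtain ⟨m, hm, rfl⟩ := Finset.mem_image.1 hg
    obtain ⟨m', hm', rfl⟩ := Finset.mem_image.1 hg'
    rw [hl.unique (hγ m (hC.mem_toFinset.1 hm)).2.1] at hl'
    rw [hl'.unique (hγ m' (hC.mem_toFinset.1 hm')).2.1]
  · intro g hg l hl
    obtain ⟨m, hm, rfl⟩ := Finset.mem_image.1 hg
    obtain ⟨-, h1, h2⟩ := hγ m (hC.mem_toFinset.1 hm)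
    rw [h2, hl.unique h1]
  · intro m hm hme
    have hmC : m ∈ C := ⟨hm, hme⟩
    exact ⟨γ m, Finset.mem_image_of_mem γ (hC.mem_toFinset.2 hmC), (hγ m hmC).2.1⟩
  · intro g hg
    obtain ⟨m, hm, rfl⟩ := Finset.mem_image.1 hg
    have hmC := hC.mem_toFinset.1 hm
    obtain ⟨h0, h1, h2⟩ := hγ m hmC
    exact ⟨h0, h2.trans_le hmC.2⟩

lemma LoopInvariant.next (hs : LoopInvariant J s) (hP : IsRelationSet J s P)
    (hB' : IsNewBasis s.B (newRelations s P d) e B')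
    (hG' : IsNewFamily B' (newRelations s P d) e G') : LoopInvariant J ⟨e, B', G'⟩ where
  connected := hB'.1
  degree_le _ hm := hB'.degree_le hm
  complete := hG'.1
  totalDegree_le g hg := (hG'.2 g hg).2
  mem_ideal g hg := newRelations_le_ideal hs hP g (hG'.2 g hg).1

/-! ### Stability below the degree of new relations in ⟨B⟩ -/

section LowDegree

variable {k : ℕ}

/-- Below the least degree of a new relation in `⟨B⟩` the monomial set does not change. -/
lemma IsNewBasis.mem_iff (hs : LoopInvariant J s) (hed : e ≤ d) (hke : k ≤ e) (hkt : k ≤ s.t)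
    (hB' : IsNewBasis s.B (newRelations s P d) e B')
    (hW : ∀ w ∈ newRelations s P d, w ∈ mspan (s.B : Set (Mon n)) → w ≠ 0 → k < w.totalDegree)
    {m : Mon n} (hm : m.degree ≤ k) : m ∈ B' ↔ m ∈ s.B := by
  refine ⟨fun h => hB'.mem_of_degree_le hs hed h (hm.trans hkt), fun h => ?_⟩
  have h1 := hB'.2.2.2 k hke
  have h2 : newRelations s P d ⊓ mspan (upTo (s.B : Set (Mon n)) k) = ⊥ := by
    rw [eq_bot_iff]
    rintro w ⟨hw, hwB⟩
    by_contra hw0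
    obtain ⟨h3, h4⟩ := mem_mspan_upTo.1 hwB
    have := hW w hw h3 hw0
    omega
  rw [h2, sup_bot_eq] at h1
  exact (subset_of_mspan_le h1.ge (show m ∈ upTo (s.B : Set (Mon n)) k from ⟨h, hm⟩)).1.2

lemma isLead_congr {B B' : Set (Mon n)} (hBB' : ∀ m : Mon n, m.degree ≤ k → (m ∈ B' ↔ m ∈ B))
    {g : Poly n} (hg : g.totalDegree ≤ k) {m : Mon n} (hl : IsLead B g m) : IsLead B' g m := by
  have hmk := (degree_le_of_mem_support hl.mem_support).trans hg
  refine ⟨⟨?_, fun h => hl.1.2 ((hBB' m hmk).1 h)⟩, hl.2.1, fun m' hm' hne =>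
    (hBB' m' ((degree_le_of_mem_support hm').trans hg)).2 (hl.2.2 m' hm' hne)⟩
  obtain ⟨i, b, hb, rfl⟩ := hl.1.1.resolve_left hl.1.2
  rw [map_add, Finsupp.degree_single] at hmk
  exact single_add_mem_prolong ((hBB' b (by omega)).2 hb) i

/-- Below the least degree of a new relation in `⟨B⟩` the rewriting family does not change. -/
lemma IsNewFamily.mem_iff (hs : LoopInvariant J s) (hed : e ≤ d) (hke : k ≤ e) (hkt : k ≤ s.t)
    (hB' : IsNewBasis s.B (newRelations s P d) e B')
    (hG' : IsNewFamily B' (newRelations s P d) e G')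
    (hW : ∀ w ∈ newRelations s P d, w ∈ mspan (s.B : Set (Mon n)) → w ≠ 0 → k < w.totalDegree)
    {g : Poly n} (hg : g.totalDegree ≤ k) : g ∈ G' ↔ g ∈ s.G := by
  have hiff : ∀ m : Mon n, m.degree ≤ k → (m ∈ (B' : Set (Mon n)) ↔ m ∈ (s.B : Set (Mon n))) :=
    fun m hm => hB'.mem_iff hs hed hke hkt hW hm
  constructor
  · intro h
    obtain ⟨m, hl⟩ := hG'.1.1.1 g h
    have hmk := (degree_le_of_mem_support hl.mem_support).trans hg
    obtain ⟨g₁, hg₁, hl₁, hd₁⟩ := hs.exists_lead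
      (isLead_congr (fun m hm => (hiff m hm).symm) hg hl).1 (hmk.trans hkt)
    have hl₁' := isLead_congr hiff (hd₁.trans_le hmk) hl₁
    rwa [hB'.eq_of_isLead (hG'.2 g h).1 (mem_newRelations_of_mem hs hg₁ (by omega)) (by omega)
      (by omega) hl hl₁']
  · intro h
    obtain ⟨m, hl⟩ := hs.complete.1.1 g h
    have hmk := (degree_le_of_mem_support hl.mem_support).trans hg
    have hl' := isLead_congr hiff hg hl
    obtain ⟨g₁, hg₁, hl₁⟩ := hG'.1.2.2 m hl'.1 (hmk.trans hke)
    rwa [hB'.eq_of_isLead (mem_newRelations_of_mem hs h (by omega)) (hG'.2 g₁ hg₁).1 (by omega)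
      (hG'.2 g₁ hg₁).2 hl' hl₁]

end LowDegree

/-- A new relation in `⟨B⟩` removes a monomial from `B`. -/
lemma IsNewBasis.exists_removed (hB' : IsNewBasis s.B (newRelations s P d) e B') {w : Poly n}
    (hw : w ∈ newRelations s P d) (hwB : w ∈ mspan (s.B : Set (Mon n))) (hw0 : w ≠ 0)
    (hwe : w.totalDegree ≤ e) : ∃ m ∈ s.B, m ∉ B' ∧ m.degree ≤ w.totalDegree := by
  by_contra! hcon
  refine hw0 (hB'.eq_zero_of_mem hw (fun m hm => ?_) hwe)
  by_contra hm'
  exact absurd (degree_le_of_mem_support (p := w) hm) (hcon m (hwB hm) hm').not_ge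

end Pass

/-! ### A common description of the passes of both loops -/

/-- The common features of a pass of the radical and of the border basis loop: `P` is the set of
added relations, `d` their least degree, and `e₀` the least degree of a new relation in `⟨B⟩`. -/
structure IsPass (J : Ideal (Poly n)) (F : Finset (Poly n)) (s s' : State n) (P : Set (Poly n))
    (d e₀ : ℕ) : Prop where
  rel : IsRelationSet J s P
  least : IsLeastDegree P (s.t + 1) d
  input : ∀ f ∈ F, f.totalDegree ≤ s.t + 1 →
    ∃ r ∈ P, IsFullReduction (s.B : Set (Mon n)) (s.G : Set (Poly n)) f r
  leastNew : IsLeastDegree ((newRelations s P d ⊓ mspan (s.B : Set (Mon n)) :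
    Submodule ℂ (Poly n)) : Set (Poly n)) d e₀
  le_t : e₀ ≤ s'.t
  t_le : s'.t ≤ d
  basis : IsNewBasis s.B (newRelations s P d) s'.t s'.B
  family : IsNewFamily s'.B (newRelations s P d) s'.t s'.G

section

variable {J : Ideal (Poly n)} {F : Finset (Poly n)} {s s' : State n} {P : Set (Poly n)} {d e₀ : ℕ}

lemma LoopInvariant.next_of_isPass (hs : LoopInvariant J s) (h : IsPass J F s s' P d e₀) :
    LoopInvariant J s' :=
  hs.next h.rel h.basis h.family

lemma LoopInvariant.totalDegree_le_of_mem (hs : LoopInvariant J s) {p : Poly n}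
    (hp : p ∈ mspan (s.B : Set (Mon n))) : p.totalDegree ≤ s.t :=
  totalDegree_le_iff.2 fun m hm => hs.degree_le m (hp hm)

/-- Either some new relation in `⟨B⟩` has degree `e₀ ≤ t`, or there is none and `e₀ = t + 1`. -/
lemma IsPass.dichotomy (hs : LoopInvariant J s) (h : IsPass J F s s' P d e₀) :
    (∃ w ∈ newRelations s P d, w ∈ mspan (s.B : Set (Mon n)) ∧ w ≠ 0 ∧ w.totalDegree = e₀ ∧
      e₀ ≤ s.t) ∨
    ((∀ w ∈ newRelations s P d, w ∈ mspan (s.B : Set (Mon n)) → w = 0) ∧ d = s.t + 1 ∧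
      e₀ = s.t + 1) := by
  rcases h.leastNew with ⟨w, hw, hw0, hwe, -⟩ | ⟨hz, he⟩
  · exact Or.inl ⟨w, hw.1, hw.2, hw0, hwe, hwe ▸ hs.totalDegree_le_of_mem hw.2⟩
  · have hW : ∀ w ∈ newRelations s P d, w ∈ mspan (s.B : Set (Mon n)) → w = 0 :=
      fun w hw hwB => hz w ⟨hw, hwB⟩
    have hd := least_eq_of_disjoint h.rel h.least hW
    exact Or.inr ⟨hW, hd, by omega⟩

lemma IsPass.le_totalDegree (h : IsPass J F s s' P d e₀) {w : Poly n}
    (hw : w ∈ newRelations s P d) (hwB : w ∈ mspan (s.B : Set (Mon n))) (hw0 : w ≠ 0) :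
    e₀ ≤ w.totalDegree :=
  h.leastNew.le_totalDegree ⟨hw, hwB⟩ hw0

lemma IsPass.one_le (hJ : J ≠ ⊤) (hs : LoopInvariant J s) (h : IsPass J F s s' P d e₀) :
    1 ≤ e₀ := by
  rcases h.dichotomy hs with ⟨w, hw, -, hw0, hwe, -⟩ | ⟨-, -, he⟩
  · exact hwe ▸ one_le_totalDegree hJ (newRelations_le_ideal hs h.rel w hw) hw0
  · omega

/-- What holds when a pass does not change `B` and `G`. -/
theorem IsPass.of_stable (hs : LoopInvariant J s) (h : IsPass J F s s' P d e₀)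
    (hG : s'.G = s.G) (hB : s'.B = s.B) :
    IsBorderBasis (s.B : Set (Mon n)) (s.G : Set (Poly n)) ∧
      (∀ p ∈ P, p ∈ mspan (s.B : Set (Mon n)) → p = 0) ∧
      (F.sup totalDegree < s'.t → ∀ f ∈ F, f ∈ Ideal.span (s.G : Set (Poly n))) := by
  rcases h.dichotomy hs with ⟨w, hw, hwB, hw0, hwe, -⟩ | ⟨hW, hd, he⟩
  -- A new relation in ⟨B⟩ would have removed a monomial from B, which is unchanged.
  · obtain ⟨m, hm, hm', -⟩ := h.basis.exists_removed hw hwB hw0 (hwe ▸ h.le_t)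
    exact absurd (hB ▸ hm) hm'
  have ht : s'.t = s.t + 1 := by
    have := h.le_t
    have := h.t_le
    omega
  have hlead : ∀ m ∈ border (s.B : Set (Mon n)), ∃ g ∈ (s.G : Set (Poly n)),
      IsLead (s.B : Set (Mon n)) g m := by
    intro m hm
    have hmt : m.degree ≤ s.t + 1 := by
      obtain ⟨i, b, hb, rfl⟩ := hm.1.resolve_left hm.2
      rw [map_add, Finsupp.degree_single]
      have := hs.degree_le b hb
      omega
    have hfam := h.family.1.2.2
    rw [hB, hG, ht] at hfam
    exact hfam m hm hmt
  have hcompl := isCompl_of_disjoint_prolong hs.connected hs.complete.1.1 hlead (by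
    rw [Submodule.disjoint_def]
    intro w hw hwB
    refine hW w ⟨Submodule.span_mono Set.subset_union_left hw, ?_⟩ hwB
    have := hs.totalDegree_le_of_mem hwB
    exact mem_mspan_upTo.2 ⟨mspan_mono (subset_prolong _) hwB, by omega⟩)
  -- Nonzero added relations have degree at least d = t + 1, while ⟨B⟩ lives in degrees at most t.
  have hP : ∀ p ∈ P, p ∈ mspan (s.B : Set (Mon n)) → p = 0 := by
    intro p hp hpB
    by_contra hp0
    have h1 := h.least.le_totalDegree hp hp0
    have h2 := hs.totalDegree_le_of_mem hpB
    omega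
  refine ⟨⟨hs.connected, fun t => ⟨hs.complete.1, hs.complete.2.1, fun m hm _ => hlead m hm⟩,
    hcompl⟩, hP, fun hF f hf => ?_⟩
  have hfd : f.totalDegree ≤ s.t + 1 := by
    have : f.totalDegree ≤ F.sup totalDegree := Finset.le_sup hf
    omega
  obtain ⟨r, hr, hred, hirr⟩ := h.input f hf hfd
  have hrB : r ∈ mspan (s.B : Set (Mon n)) := by
    rw [mem_mspan]
    intro m hm
    rcases mem_of_irreducible hs.connected.1 (t := m.degree) (fun m hm _ => hlead m hm) hirr hm
      (by omega) with h' | h'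
    · exact h'
    · omega
  have h1 := hred.sub_mem hs.complete.2.1
  rwa [hP r hr hrB, sub_zero] at h1

end

/-! ### Termination -/

section Termination

variable {J : Ideal (Poly n)} {F : Finset (Poly n)} {s : ℕ → State n} {P : ℕ → Set (Poly n)}
  {d e₀ : ℕ → ℕ}

lemma mem_iff_of_lt (hs : ∀ k, LoopInvariant J (s k))
    (h : ∀ k, IsPass J F (s k) (s (k + 1)) (P k) (d k) (e₀ k))
    {k D : ℕ} (hD : D < e₀ k) :
    (∀ m : Mon n, m.degree ≤ D → (m ∈ (s (k + 1)).B ↔ m ∈ (s k).B)) ∧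
      ∀ g : Poly n, g.totalDegree ≤ D → (g ∈ (s (k + 1)).G ↔ g ∈ (s k).G) := by
  have hDt : D ≤ (s k).t := by
    rcases (h k).dichotomy (hs k) with ⟨w, -, -, -, -, h'⟩ | ⟨-, -, h'⟩ <;> omega
  have hle := (h k).le_t
  have hW : ∀ w ∈ newRelations (s k) (P k) (d k), w ∈ mspan ((s k).B : Set (Mon n)) → w ≠ 0 →
      D < w.totalDegree := fun w hw hwB hw0 => hD.trans_le ((h k).le_totalDegree hw hwB hw0)
  exact ⟨fun m hm => (h k).basis.mem_iff (hs k) (h k).t_le (by omega) hDt hW hm,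
    fun g hg => (h k).family.mem_iff (hs k) (h k).t_le (by omega) hDt (h k).basis hW hg⟩

/-- In an infinite run the least degree of a new relation tends to infinity. -/
lemma eventually_lt (hs : ∀ k, LoopInvariant J (s k))
    (h : ∀ k, IsPass J F (s k) (s (k + 1)) (P k) (d k) (e₀ k))
    (hJ : J ≠ ⊤) (D : ℕ) : ∀ᶠ k in Filter.atTop, D < e₀ k := by
  classical
  induction D with
  | zero => exact Filter.Eventually.of_forall fun k => (h k).one_le hJ (hs k)
  | succ D ih =>
    obtain ⟨N, hN⟩ := Filter.eventually_atTop.1 ih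
    -- Once e₀ > D and D + 1 ≤ t hold permanently, this count never grows, and it drops whenever e₀
    -- = D + 1; so that happens finitely often.
    let c : ℕ → ℕ := fun k => ((s k).B.filter fun m => m.degree ≤ D + 1).card
    have hstep : ∀ k, N + 1 ≤ k → c (k + 1) ≤ c k ∧ (e₀ k = D + 1 → c (k + 1) < c k) := by
      intro k hk
      have hek := hN k (by omega)
      have htk : D + 1 ≤ (s k).t := by
        -- The bound on t comes from the preceding pass, whence the shift to N + 1.
        obtain ⟨k, rfl⟩ : ∃ j, k = j + 1 := ⟨k - 1, by omega⟩
        exact le_trans (hN k (by omega)) (h k).le_t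
      have hsub : ((s (k + 1)).B.filter fun m => m.degree ≤ D + 1) ⊆
          ((s k).B.filter fun m => m.degree ≤ D + 1) := by
        intro m hm
        rw [Finset.mem_filter] at hm ⊢
        exact ⟨(h k).basis.mem_of_degree_le (hs k) (h k).t_le hm.1 (hm.2.trans htk), hm.2⟩
      refine ⟨Finset.card_le_card hsub, fun he => Finset.card_lt_card
        ((Finset.ssubset_iff_of_subset hsub).2 ?_)⟩
      rcases (h k).dichotomy (hs k) with ⟨w, hw, hwB, hw0, hwe, -⟩ | ⟨-, -, h'⟩
      · obtain ⟨m, hm, hm', hmd⟩ := (h k).basis.exists_removed hw hwB hw0 (hwe ▸ (h k).le_t)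
        exact ⟨m, Finset.mem_filter.2 ⟨hm, by omega⟩, fun hc => hm' (Finset.mem_filter.1 hc).1⟩
      · omega
    have hanti : Antitone fun j => c (N + 1 + j) :=
      antitone_nat_of_succ_le fun j => (hstep (N + 1 + j) (by omega)).1
    obtain ⟨M, hM⟩ := WellFoundedLT.antitone_chain_condition hanti
    refine Filter.eventually_atTop.2 ⟨N + 1 + M, fun k hk => ?_⟩
    obtain ⟨j, rfl⟩ : ∃ j, k = N + 1 + j := ⟨k - (N + 1), by omega⟩
    by_contra hcon
    have h1 := hN (N + 1 + j) (by omega)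
    have h2 := (hstep (N + 1 + j) (by omega)).2 (by omega)
    have h3 := hM j (by omega)
    have h4 := hM (j + 1) (by omega)
    simp only [← add_assoc] at h3 h4
    omega

/-- The limits of the monomial sets and of the rewriting families of an infinite run. -/
lemma exists_limit (hs : ∀ k, LoopInvariant J (s k))
    (h : ∀ k, IsPass J F (s k) (s (k + 1)) (P k) (d k) (e₀ k))
    (hJ : J ≠ ⊤) : ∃ (B : Set (Mon n)) (G : Set (Poly n)), ∀ D : ℕ,
    ∀ᶠ k in Filter.atTop, D < e₀ k ∧ D ≤ (s k).t ∧
      (∀ m : Mon n, m.degree ≤ D → (m ∈ (s k).B ↔ m ∈ B)) ∧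
      ∀ g : Poly n, g.totalDegree ≤ D → (g ∈ (s k).G ↔ g ∈ G) := by
  refine ⟨{m | ∀ᶠ k in Filter.atTop, m ∈ (s k).B}, {g | ∀ᶠ k in Filter.atTop, g ∈ (s k).G},
    fun D => ?_⟩
  obtain ⟨N, hN⟩ := Filter.eventually_atTop.1 (eventually_lt hs h hJ D)
  have hB : ∀ m : Mon n, m.degree ≤ D → ∀ k, N ≤ k → (m ∈ (s k).B ↔ m ∈ (s N).B) := by
    intro m hm k hk
    induction k, hk using Nat.le_induction with
    | base => rfl
    | succ k hk ih => rw [(mem_iff_of_lt hs h (hN k hk)).1 m hm, ih]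
  have hG : ∀ g : Poly n, g.totalDegree ≤ D → ∀ k, N ≤ k → (g ∈ (s k).G ↔ g ∈ (s N).G) := by
    intro g hg k hk
    induction k, hk using Nat.le_induction with
    | base => rfl
    | succ k hk ih => rw [(mem_iff_of_lt hs h (hN k hk)).2 g hg, ih]
  refine Filter.eventually_atTop.2 ⟨N, fun k hk => ⟨hN k hk, ?_, fun m hm => ?_, fun g hg => ?_⟩⟩
  · have := hN k hk
    rcases (h k).dichotomy (hs k) with ⟨w, -, -, -, -, h'⟩ | ⟨-, -, h'⟩ <;> omega
  · rw [hB m hm k hk]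
    constructor
    · exact fun hmN => Filter.eventually_atTop.2 ⟨N, fun j hj => (hB m hm j hj).2 hmN⟩
    · intro hev
      obtain ⟨M, hM⟩ := Filter.eventually_atTop.1 hev
      exact (hB m hm (max M N) (le_max_right _ _)).1 (hM _ (le_max_left _ _))
  · rw [hG g hg k hk]
    constructor
    · exact fun hgN => Filter.eventually_atTop.2 ⟨N, fun j hj => (hG g hg j hj).2 hgN⟩
    · intro hev
      obtain ⟨M, hM⟩ := Filter.eventually_atTop.1 hev
      exact (hG g hg (max M N) (le_max_right _ _)).1 (hM _ (le_max_left _ _))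

/-- A relation involves finitely many generators, so one in the limit family is already present at a
late stage of the run. -/
lemma exists_mem_span_polyProlong_totalDegree_le {G : Set (Poly n)} {w : Poly n}
    (hw : w ∈ Submodule.span ℂ (polyProlong G)) :
    ∃ D, w ∈ Submodule.span ℂ (polyProlong {g | g ∈ G ∧ g.totalDegree ≤ D}) := by
  have hmono : ∀ {D D' : ℕ}, D ≤ D' →
      Submodule.span ℂ (polyProlong {g | g ∈ G ∧ g.totalDegree ≤ D}) ≤
      Submodule.span ℂ (polyProlong {g | g ∈ G ∧ g.totalDegree ≤ D'}) := by
    intro D D' hD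
    refine Submodule.span_mono ?_
    rintro p (hp | ⟨i, g, hg, rfl⟩)
    · exact Or.inl ⟨hp.1, hp.2.trans hD⟩
    · exact Or.inr ⟨i, g, ⟨hg.1, hg.2.trans hD⟩, rfl⟩
  induction hw using Submodule.span_induction with
  | mem p hp =>
    rcases hp with hp | ⟨i, g, hg, rfl⟩
    · exact ⟨p.totalDegree, Submodule.subset_span (Or.inl ⟨hp, le_rfl⟩)⟩
    · exact ⟨g.totalDegree, Submodule.subset_span (Or.inr ⟨i, g, ⟨hg, le_rfl⟩, rfl⟩)⟩
  | zero => exact ⟨0, zero_mem _⟩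
  | add a b _ _ ha hb =>
    obtain ⟨D, hD⟩ := ha
    obtain ⟨D', hD'⟩ := hb
    exact ⟨max D D', add_mem (hmono (le_max_left _ _) hD) (hmono (le_max_right _ _) hD')⟩
  | smul c a _ ha =>
    obtain ⟨D, hD⟩ := ha
    exact ⟨D, Submodule.smul_mem _ _ hD⟩

/-- Sets connected to 1 have no gaps in degree: an empty degree bounds the whole set. -/
lemma ConnectedToOne.exists_degree_eq {B : Set (Mon n)} (hB : ConnectedToOne B) {D : ℕ} :
    ∀ j, ∀ m ∈ B, m.degree = D + j → ∃ m' ∈ B, m'.degree = D := by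
  intro j
  induction j with
  | zero => exact fun m hm h => ⟨m, hm, h⟩
  | succ j ih =>
    intro m hm h
    have hm0 : m ≠ 0 := by
      rintro rfl
      simp at h
    obtain ⟨i, m', hm', rfl⟩ := hB.2 m hm hm0
    rw [map_add, Finsupp.degree_single] at h
    exact ih m' hm' (by omega)

/-- Every run reaches a pass that satisfies the stopping test. -/
theorem exists_stopTest (hs : ∀ k, LoopInvariant J (s k))
    (h : ∀ k, IsPass J F (s k) (s (k + 1)) (P k) (d k) (e₀ k))
    (hJ : J ≠ ⊤)
    (hfin : Module.Finite ℂ (Poly n ⧸ Ideal.span (F : Set (Poly n)))) :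
    ∃ k, StopTest F (s k) (s (k + 1)) := by
  obtain ⟨B, G, hlim⟩ := exists_limit hs h hJ
  have hlimk : ∀ D, ∃ k, D < e₀ k ∧ D ≤ (s k).t ∧
      (∀ m : Mon n, m.degree ≤ D → (m ∈ (s k).B ↔ m ∈ B)) ∧
      ∀ g : Poly n, g.totalDegree ≤ D → (g ∈ (s k).G ↔ g ∈ G) := fun D => (hlim D).exists
  have hconn : ConnectedToOne B := by
    constructor
    · obtain ⟨k, -, -, hB, -⟩ := hlimk 0
      exact (hB 0 (by simp)).1 (hs k).connected.1
    · intro m hm hm0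
      obtain ⟨k, -, -, hB, -⟩ := hlimk m.degree
      obtain ⟨i, m', hm', rfl⟩ := (hs k).connected.2 m ((hB m le_rfl).2 hm) hm0
      refine ⟨i, m', (hB m' ?_).1 hm', rfl⟩
      rw [map_add]
      omega
  have hleadG : ∀ g ∈ G, ∃ m, IsLead B g m := by
    intro g hg
    obtain ⟨k, -, -, hB, hG⟩ := hlimk g.totalDegree
    obtain ⟨m, hl⟩ := (hs k).complete.1.1 g ((hG g le_rfl).2 hg)
    exact ⟨m, isLead_congr (fun m hm => (hB m hm).symm) le_rfl hl⟩
  have hcover : ∀ m ∈ border B, ∃ g ∈ G, IsLead B g m ∧ g.totalDegree = m.degree := by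
    intro m hm
    obtain ⟨k, -, hkt, hB, hG⟩ := hlimk m.degree
    have hmk : m ∈ border ((s k).B : Set (Mon n)) := by
      refine ⟨?_, fun h' => hm.2 ((hB m le_rfl).1 h')⟩
      obtain ⟨i, b, hb, rfl⟩ := hm.1.resolve_left hm.2
      refine single_add_mem_prolong ((hB b ?_).2 hb) i
      rw [map_add]
      omega
    obtain ⟨g, hg, hl, hgd⟩ := (hs k).exists_lead hmk hkt
    exact ⟨g, (hG g hgd.le).1 hg, isLead_congr (fun m hm => (hB m hm).symm) hgd.le hl, hgd⟩
  -- At a stage with e₀ > deg w, a nonzero w in the intersection would be a new relation in ⟨B⟩ of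
  -- degree below e₀.
  have hdis : Disjoint (Submodule.span ℂ (polyProlong G)) (mspan B) := by
    rw [Submodule.disjoint_def]
    intro w hw hwB
    by_contra hw0
    obtain ⟨D, hD⟩ := exists_mem_span_polyProlong_totalDegree_le hw
    obtain ⟨k, hek, hkt, hB, hG⟩ := hlimk (max D w.totalDegree)
    have hwBk : w ∈ mspan ((s k).B : Set (Mon n)) := by
      rw [mem_mspan]
      intro m hm
      exact (hB m ((degree_le_of_mem_support hm).trans (le_max_right _ _))).2 (hwB hm)
    have hsub : polyProlong {g | g ∈ G ∧ g.totalDegree ≤ D} ⊆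
        polyProlong ((s k).G : Set (Poly n)) := by
      rintro p (hp | ⟨i, g, hg, rfl⟩)
      · exact Or.inl ((hG p (hp.2.trans (le_max_left _ _))).2 hp.1)
      · exact Or.inr ⟨i, g, (hG g (hg.2.trans (le_max_left _ _))).2 hg.1, rfl⟩
    have hed : e₀ k ≤ d k := (h k).le_t.trans (h k).t_le
    have hle : w.totalDegree < e₀ k := lt_of_le_of_lt (le_max_right _ _) hek
    refine absurd ((h k).le_totalDegree ⟨Submodule.span_mono
      (hsub.trans Set.subset_union_left) hD, ?_⟩ hwBk hw0) hle.not_ge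
    exact mem_mspan_upTo.2 ⟨mspan_mono (subset_prolong _) hwBk, by omega⟩
  have hcompl := isCompl_of_disjoint_prolong hconn hleadG
    (fun m hm => let ⟨g, hg, hl, _⟩ := hcover m hm; ⟨g, hg, hl⟩) hdis
  have hFG : Ideal.span (F : Set (Poly n)) ≤ Ideal.span G := by
    rw [Ideal.span_le]
    intro f hf
    obtain ⟨k, hek, hkt, hB, hG⟩ := hlimk f.totalDegree
    obtain ⟨r, hr, hred, -⟩ := (h k).input f hf (by omega)
    obtain ⟨hrd, hsub⟩ := hred.sub_mem_and_totalDegree_le (hs k).complete.2.1 le_rfl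
    -- The reduction r of f has degree at most deg f < e₀ ≤ d, and d bounds the degrees of nonzero
    -- added relations from below.
    have hr0 : r = 0 := by
      by_contra hr0
      have h1 := (h k).least.le_totalDegree hr hr0
      have h2 : e₀ k ≤ d k := (h k).le_t.trans (h k).t_le
      omega
    rw [hr0, sub_zero] at hsub
    exact Ideal.span_mono (fun g hg => (hG g hg.2).1 hg.1) hsub
  have hBfin : B.Finite := by
    have := hfin
    exact finite_of_disjoint (J := Ideal.span (F : Set (Poly n)))
      (hcompl.1.mono_right fun p hp => hFG hp)
  obtain ⟨D, hD⟩ : ∃ D, ∀ m ∈ B, m.degree ≤ D := by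
    obtain ⟨D, hD⟩ := (hBfin.image Finsupp.degree).bddAbove
    exact ⟨D, fun m hm => hD ⟨m, hm, rfl⟩⟩
  -- D + 1 reaches the whole border of the limit B and one degree in which B is empty; the other
  -- term makes the degree test of the stopping rule hold.
  let D' := max (D + 1) (F.sup totalDegree + 1)
  have hstab : ∀ k, (∀ m : Mon n, m.degree ≤ D' → (m ∈ (s k).B ↔ m ∈ B)) →
      (∀ g : Poly n, g.totalDegree ≤ D' → (g ∈ (s k).G ↔ g ∈ G)) →
      ((s k).B : Set (Mon n)) = B ∧ ((s k).G : Set (Poly n)) = G := by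
    intro k hB hG
    have hBd : ∀ m ∈ (s k).B, m.degree ≤ D := by
      intro m hm
      by_contra hcon
      obtain ⟨m', hm', hd'⟩ := (hs k).connected.exists_degree_eq (D := D + 1)
        (m.degree - (D + 1)) m hm (by omega)
      have := hD m' ((hB m' (hd'.trans_le (le_max_left _ _))).1 hm')
      omega
    have hDD' : D + 1 ≤ D' := le_max_left _ _
    have hBeq : ((s k).B : Set (Mon n)) = B := by
      ext m
      exact ⟨fun hm => (hB m (by have := hBd m hm; omega)).1 hm,
        fun hm => (hB m (by have := hD m hm; omega)).2 hm⟩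
    have hborder : ∀ m ∈ border B, m.degree ≤ D + 1 := by
      intro m hm
      obtain ⟨i, b, hb, rfl⟩ := hm.1.resolve_left hm.2
      rw [map_add, Finsupp.degree_single]
      have := hD b hb
      omega
    refine ⟨hBeq, Set.ext fun g => ⟨fun hg => (hG g ?_).1 hg, fun hg => (hG g ?_).2 hg⟩⟩
    · obtain ⟨m, hl⟩ := (hs k).complete.1.1 g hg
      rw [← (hs k).complete.2.1 g hg m hl]
      rw [hBeq] at hl
      exact (hborder m hl.1).trans hDD'
    · obtain ⟨j, -, -, hB', hG'⟩ := hlimk g.totalDegree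
      obtain ⟨m, hl⟩ := (hs j).complete.1.1 g ((hG' g le_rfl).2 hg)
      rw [← (hs j).complete.2.1 g ((hG' g le_rfl).2 hg) m hl]
      exact (hborder m (isLead_congr (fun m hm => (hB' m hm).symm) le_rfl hl).1).trans hDD'
  obtain ⟨N, hN⟩ := Filter.eventually_atTop.1 (hlim D')
  obtain ⟨-, -, h1, h2⟩ := hN N le_rfl
  obtain ⟨-, ht, h3, h4⟩ := hN (N + 1) (by omega)
  obtain ⟨hB1, hG1⟩ := hstab _ h1 h2
  obtain ⟨hB2, hG2⟩ := hstab _ h3 h4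
  refine ⟨N, Finset.coe_injective (hG2.trans hG1.symm), Finset.coe_injective (hB2.trans hB1.symm),
    ?_⟩
  exact Nat.lt_of_lt_of_le (Nat.lt_succ_self _) ((le_max_right _ _).trans ht)

end Termination

/-! ### The passes of the two loops -/

section Passes

variable {J : Ideal (Poly n)} {F : Finset (Poly n)} {s s' : State n}

lemma mem_mspan_of_irreducible (hs : LoopInvariant J s) {q : Poly n}
    (hq : ∀ q', ¬ RedStep (s.B : Set (Mon n)) (s.G : Set (Poly n)) q q')
    (hqt : q.totalDegree ≤ s.t) : q ∈ mspan (s.B : Set (Mon n)) := by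
  rw [mem_mspan]
  intro m hm
  have hmt := (degree_le_of_mem_support hm).trans hqt
  rcases mem_of_irreducible hs.connected.1 hs.complete.2.2 hq hm (by omega) with h | h
  · exact h
  · omega

lemma exists_isReducedInput (hs : LoopInvariant J s) (F : Finset (Poly n)) :
    ∃ Ft, IsReducedInput F s Ft := by
  choose ρ hρ using
    exists_isFullReduction (B := (s.B : Set (Mon n))) (G := (s.G : Set (Poly n))) hs.connected.1
  refine ⟨_, ρ, fun f _ hft => ⟨hρ f, ?_⟩, rfl⟩
  have hd := ((hρ f).1.sub_mem_and_totalDegree_le hs.complete.2.1 hft).1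
  refine mem_mspan_upTo.2 ⟨mem_mspan.2 fun m hm => ?_, hd⟩
  rcases mem_of_irreducible hs.connected.1 hs.complete.2.2 (hρ f).2 hm
    ((degree_le_of_mem_support hm).trans hd) with h | h
  · exact subset_prolong _ h
  · exact h.1.1

lemma IsReducedInput.isRelationSet (hs : LoopInvariant J s) (hF : ∀ f ∈ F, f ∈ J)
    {Ft : Set (Poly n)} (hFt : IsReducedInput F s Ft) : IsRelationSet J s Ft := by
  obtain ⟨ρ, hρ, rfl⟩ := hFt
  refine ⟨?_, ?_, ?_⟩
  · rintro _ ⟨f, hf, rfl⟩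
    exact (hρ f hf.1 hf.2).2
  · rintro _ ⟨f, hf, rfl⟩ hd
    exact mem_mspan_of_irreducible hs (hρ f hf.1 hf.2).1.2 hd
  · rintro _ ⟨f, hf, rfl⟩
    have h1 := (hρ f hf.1 hf.2).1.1.sub_mem hs.complete.2.1
    have h2 : Ideal.span (s.G : Set (Poly n)) ≤ J := Ideal.span_le.2 hs.mem_ideal
    simpa using sub_mem (hF f hf.1) (h2 h1)

lemma IsReducedInput.exists_fullReduction {Ft : Set (Poly n)} (hFt : IsReducedInput F s Ft) :
    ∀ f ∈ F, f.totalDegree ≤ s.t + 1 →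
      ∃ r ∈ Ft, IsFullReduction (s.B : Set (Mon n)) (s.G : Set (Poly n)) f r := by
  obtain ⟨ρ, hρ, rfl⟩ := hFt
  exact fun f hf hd => ⟨ρ f, ⟨f, ⟨hf, hd⟩, rfl⟩, (hρ f hf hd).1⟩

lemma IsRelationSet.union {P Q : Set (Poly n)} (hP : IsRelationSet J s P)
    (hQ : IsRelationSet J s Q) : IsRelationSet J s (P ∪ Q) where
  mem_mspan p hp := hp.elim (hP.mem_mspan p) (hQ.mem_mspan p)
  mem_of_le p hp := hp.elim (hP.mem_of_le p) (hQ.mem_of_le p)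
  mem_ideal p hp := hp.elim (hP.mem_ideal p) (hQ.mem_ideal p)

lemma isRelationSet_of_subset_mspan (hs : LoopInvariant J s) {K : Set (Poly n)}
    (hKB : ∀ p ∈ K, p ∈ mspan (s.B : Set (Mon n))) (hKJ : ∀ p ∈ K, p ∈ J) :
    IsRelationSet J s K where
  mem_mspan p hp := mem_mspan_upTo.2 ⟨mspan_mono (subset_prolong _) (hKB p hp),
    (hs.totalDegree_le_of_mem (hKB p hp)).trans (Nat.le_succ _)⟩
  mem_of_le p hp _ := hKB p hp
  mem_ideal := hKJ

/-- The least degree of a new relation in `⟨B⟩`, and a new monomial set in that degree. -/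
lemma exists_least_newBasis (hJ : J ≠ ⊤) (hs : LoopInvariant J s) {P : Set (Poly n)} {d : ℕ}
    (hP : IsRelationSet J s P) (hd : IsLeastDegree P (s.t + 1) d) :
    ∃ e₀, IsLeastDegree ((newRelations s P d ⊓ mspan (s.B : Set (Mon n)) :
      Submodule ℂ (Poly n)) : Set (Poly n)) d e₀ ∧ e₀ ≤ d ∧
      ∃ B', IsNewBasis s.B (newRelations s P d) e₀ B' := by
  obtain ⟨e₀, he⟩ := exists_isLeastDegree
    ((newRelations s P d ⊓ mspan (s.B : Set (Mon n)) : Submodule ℂ (Poly n)) : Set (Poly n)) d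
  have hed : e₀ ≤ d := he.le fun p hp => (mem_mspan_upTo.1 (newRelations_le hp.1)).2
  have he1 : 1 ≤ e₀ := by
    rcases he with ⟨w, hw, hw0, rfl, -⟩ | ⟨-, rfl⟩
    · exact one_le_totalDegree hJ (newRelations_le_ideal hs hP w hw.1) hw0
    · exact hP.one_le hd hJ
  exact ⟨e₀, he, hed, exists_isNewBasis hs (hP.least_le hd) he1 hed fun w hw hwB hw0 =>
    he.le_totalDegree ⟨hw, hwB⟩ hw0⟩

lemma BorderPass.isPass (hs : LoopInvariant J s) (hF : ∀ f ∈ F, f ∈ J) (h : BorderPass F s s') :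
    ∃ P d e₀, IsPass J F s s' P d e₀ := by
  obtain ⟨Ft, d, h1, h2, h3, h4, h5⟩ := h
  exact ⟨Ft, d, s'.t, h1.isRelationSet hs hF, h2, h1.exists_fullReduction, h3, le_rfl,
    h3.le fun p hp => (mem_mspan_upTo.1 (newRelations_le hp.1)).2, h4, h5⟩

lemma exists_borderPass (hJ : J ≠ ⊤) (hs : LoopInvariant J s) (hF : ∀ f ∈ F, f ∈ J) :
    ∃ s', BorderPass F s s' := by
  obtain ⟨Ft, hFt⟩ := exists_isReducedInput hs F
  have hP := hFt.isRelationSet hs hF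
  obtain ⟨d, hd⟩ := exists_isLeastDegree Ft (s.t + 1)
  obtain ⟨e₀, he, hed, B', hB'⟩ := exists_least_newBasis hJ hs hP hd
  obtain ⟨G', hG'⟩ := hB'.exists_isNewFamily hs (hP.least_le hd) hed
  exact ⟨⟨e₀, B', G'⟩, Ft, d, hFt, hd, he, hB', hG'⟩

/-- Because G ⊂ √I, every zero of F is a zero of G, so kernel elements vanish at all zeros of F and
the Nullstellensatz applies. -/
lemma IsGenericKernel.isRelationSet {F₀ : Set (Poly n)}
    (hs : LoopInvariant (Ideal.span F₀).radical s)
    {S : Finset (Mon n)} (hS : IsMaxReducible s S) {Λ : Poly n →ₗ[ℂ] ℂ} {K : Set (Poly n)}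
    (hK : IsGenericKernel (s.B : Set (Mon n)) (s.G : Set (Poly n)) S Λ K) :
    (∀ p ∈ K, p ∈ mspan (s.B : Set (Mon n))) ∧ IsRelationSet (Ideal.span F₀).radical s K := by
  have hker : ∀ p ∈ K, p ∈ kerPoly (hankel Λ S) := fun p hp => hK.2.2 ▸ Submodule.subset_span hp
  have hKB : ∀ p ∈ K, p ∈ mspan (s.B : Set (Mon n)) := fun p hp =>
    mspan_mono (fun m hm => (hS.prop.1 hm).1) (kerPoly_le_mspan _ (hker p hp))
  refine ⟨hKB, isRelationSet_of_subset_mspan hs hKB fun p hp => mem_radical_of_forall_eval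
    fun v hv => eval_eq_zero_of_isGenericForm hK.1 (fun g hg => ?_) (hker p hp)⟩
  exact eval_eq_zero_of_mem_radical (hs.mem_ideal g hg) hv

lemma RadicalPass.isPass (hJ : (Ideal.span (F : Set (Poly n))).radical ≠ ⊤)
    (hs : LoopInvariant (Ideal.span (F : Set (Poly n))).radical s) {Λ : Poly n →ₗ[ℂ] ℂ}
    (h : RadicalPass F s Λ s') :
    ∃ (S : Finset (Mon n)) (K P : Set (Poly n)) (d e₀ : ℕ), IsMaxReducible s S ∧
      IsGenericKernel (s.B : Set (Mon n)) (s.G : Set (Poly n)) S Λ K ∧ K ⊆ P ∧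
      IsPass (Ideal.span (F : Set (Poly n))).radical F s s' P d e₀ := by
  obtain ⟨S, K, Ft, d, hS, hK, hFt, hd, hgr, hB', hG'⟩ := h
  have hP := (hFt.isRelationSet hs fun f hf => Ideal.le_radical (Ideal.subset_span hf)).union
    (hK.isRelationSet hs hS).2
  obtain ⟨e₀, he, hed, hB''⟩ := exists_least_newBasis hJ hs hP hd
  -- The degree e₀ admits a new monomial set, so the maximal choice of t'' + 1 is at least e₀.
  refine ⟨S, K, Ft ∪ K, d, e₀, hS, hK, Set.subset_union_right, hP, hd, fun f hf hfd => ?_, he,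
    hgr.2 ⟨hed, hB''⟩, hgr.1.1, hB', hG'⟩
  obtain ⟨r, hr, hr'⟩ := hFt.exists_fullReduction f hf hfd
  exact ⟨r, Or.inl hr, hr'⟩

lemma exists_isMaxReducible (s : State n) : ∃ S, IsMaxReducible s S := by
  have hfin : {T : Finset (Mon n) | (T : Set (Mon n)) ⊆ upTo (s.B : Set (Mon n)) (s.t + 1) ∧
      ∀ m ∈ prodSet (T : Set (Mon n)), ∃ p,
        ProjectsTo (s.B : Set (Mon n)) (s.G : Set (Poly n)) m p ∧
        p ∈ mspan (upTo (s.B : Set (Mon n)) (s.t + 1))}.Finite :=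
    (s.B.powerset.finite_toSet).subset fun T hT =>
      Finset.mem_coe.2 (Finset.mem_powerset.2 fun m hm => (hT.1 hm).1)
  obtain ⟨S, hS⟩ := hfin.exists_maximal ⟨∅, by simp, by simp [prodSet]⟩
  exact ⟨S, hS⟩

lemma exists_radicalPass (hJ : (Ideal.span (F : Set (Poly n))).radical ≠ ⊤)
    (hs : LoopInvariant (Ideal.span (F : Set (Poly n))).radical s) :
    ∃ Λ s', RadicalPass F s Λ s' := by
  classical
  obtain ⟨S, hS⟩ := exists_isMaxReducible s
  obtain ⟨Λ, K, hK⟩ := exists_isGenericKernel (s.B : Set (Mon n)) (s.G : Set (Poly n)) S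
  obtain ⟨Ft, hFt⟩ := exists_isReducedInput hs F
  have hP := (hFt.isRelationSet hs fun f hf => Ideal.le_radical (Ideal.subset_span hf)).union
    (hK.isRelationSet hs hS).2
  obtain ⟨d, hd⟩ := exists_isLeastDegree (Ft ∪ K) (s.t + 1)
  obtain ⟨e₀, he, hed, hB''⟩ := exists_least_newBasis hJ hs hP hd
  obtain ⟨e, hgr⟩ : ∃ e, IsGreatest
      {e | e ≤ d ∧ ∃ B', IsNewBasis s.B (newRelations s (Ft ∪ K) d) e B'} e :=
    BddAbove.exists_isGreatest_of_nonempty ⟨d, fun e he => he.1⟩ ⟨e₀, hed, hB''⟩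
  obtain ⟨-, B', hB'⟩ := hgr.1
  obtain ⟨G', hG'⟩ := hB'.exists_isNewFamily hs (hP.least_le hd) hgr.1.1
  exact ⟨Λ, ⟨e, B', G'⟩, S, K, Ft, d, hS, hK, hFt, hd, hgr, hB', hG'⟩

/-- If every monomial projects to `⟨B⟩`, then the maximal reducible set is `B`. -/
lemma IsMaxReducible.eq (hs : LoopInvariant J s) {S : Finset (Mon n)} (hS : IsMaxReducible s S)
    (hlead : ∀ m ∈ border (s.B : Set (Mon n)), ∃ g ∈ (s.G : Set (Poly n)),
      IsLead (s.B : Set (Mon n)) g m) : S = s.B := by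
  have hsub : S ≤ s.B := fun m hm => (hS.prop.1 hm).1
  refine le_antisymm hsub (hS.le_of_ge ⟨fun m hm => ⟨hm, ?_⟩, fun m _ => ?_⟩ hsub)
  · have := hs.degree_le m hm
    omega
  · obtain ⟨p, hp, hpp⟩ := exists_projectsTo (G := (s.G : Set (Poly n))) hs.connected.1 hlead m
    exact ⟨p, hpp, mem_mspan_upTo.2 ⟨hp, (hs.totalDegree_le_of_mem hp).trans (Nat.le_succ _)⟩⟩

lemma isUnit_det_of_kerPoly_eq_bot {S : Finset (Mon n)} {M : Matrix S S ℂ}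
    (h : ∀ p ∈ kerPoly M, p = 0) : IsUnit M.det := by
  rw [isUnit_iff_ne_zero]
  intro hdet
  obtain ⟨u, hu0, hu⟩ := Matrix.exists_mulVec_eq_zero_iff.2 hdet
  apply hu0
  have h1 := h _ (mem_kerPoly.2 ⟨u, hu, rfl⟩)
  funext m
  have h2 := congrArg (coeff m.1) h1
  simpa [coeff_sum, coeff_monomial, Subtype.val_inj] using h2

end Passes

/-! ### Runs of the algorithm -/

section Runs

variable {F : Finset (Poly n)}

/-- The properties of the configurations that can be reached. -/
def GoodConfig (F : Finset (Poly n)) : Config n → Prop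
  | .main s => LoopInvariant (Ideal.span (F : Set (Poly n))).radical s
  | .socleCall B G Λ => IsBorderBasis (B : Set (Mon n)) (G : Set (Poly n)) ∧
      (Ideal.span (G : Set (Poly n))).radical = (Ideal.span (F : Set (Poly n))).radical ∧
      (∀ κ ∈ redFamily (B : Set (Mon n)) (G : Set (Poly n)) (B : Set (Mon n)), Λ κ = 0) ∧
      IsUnit (hankel Λ B).det
  | .socle F' s => Ideal.span (F' : Set (Poly n)) = (Ideal.span (F : Set (Poly n))).radical ∧
      LoopInvariant (Ideal.span (F : Set (Poly n))).radical s
  | .done B G => IsBorderBasis (B : Set (Mon n)) (G : Set (Poly n)) ∧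
      Ideal.span (G : Set (Poly n)) = (Ideal.span (F : Set (Poly n))).radical

lemma IsBorderBasis.exists_lead {B : Set (Mon n)} {G : Set (Poly n)} (h : IsBorderBasis B G) :
    ∀ m ∈ border B, ∃ g ∈ G, IsLead B g m := fun m hm => (h.2.1 m.degree).2.2 m hm le_rfl

/-- K lies in ⟨B⟩ and consists of added relations, so at a stable pass K = 0. Since S = B there, the
Hankel matrix on B has trivial kernel: the invertibility required by the socle step holds
automatically. -/
lemma goodConfig_of_exit (hJ : (Ideal.span (F : Set (Poly n))).radical ≠ ⊤) {s s' : State n}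
    {Λ : Poly n →ₗ[ℂ] ℂ} (hs : LoopInvariant (Ideal.span (F : Set (Poly n))).radical s)
    (h : RadicalPass F s Λ s') (hStopTest : StopTest F s s') :
    GoodConfig F (.socleCall s.B s.G Λ) := by
  obtain ⟨S, K, P, d, e₀, hS, hK, hKP, hpass⟩ := h.isPass hJ hs
  obtain ⟨hbb, hP, hF⟩ := hpass.of_stable hs hStopTest.1 hStopTest.2.1
  obtain rfl : S = s.B := hS.eq hs hbb.exists_lead
  have hK0 : ∀ p ∈ K, p = 0 := fun p hp => hP p (hKP hp) ((hK.isRelationSet hs hS).1 p hp)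
  refine ⟨hbb, le_antisymm ?_ ?_, hK.1.1, isUnit_det_of_kerPoly_eq_bot fun p hp => ?_⟩
  · exact Ideal.radical_le_radical_iff.2 (Ideal.span_le.2 hs.mem_ideal)
  · exact Ideal.radical_mono (Ideal.span_le.2 (hF hStopTest.2.2))
  · rw [← hK.2.2] at hp
    have : Submodule.span ℂ K ≤ ⊥ := Submodule.span_le.2 fun p hp => hK0 p hp
    exact this hp

lemma GoodConfig.trans (hJ : (Ideal.span (F : Set (Poly n))).radical ≠ ⊤) {c c' : Config n}
    (hc : GoodConfig F c) (h : Trans F c c') : GoodConfig F c' := by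
  cases h with
  | loop s s' Λ hp _ =>
    obtain ⟨S, K, P, d, e₀, -, -, -, hpass⟩ := hp.isPass hJ hc
    exact LoopInvariant.next_of_isPass hc hpass
  | loopExit s s' Λ hp hStopTest => exact goodConfig_of_exit hJ hc hp hStopTest
  | socleStart B G Λ F' hF' =>
    obtain ⟨hbb, hrad, hΛ, -⟩ := hc
    refine ⟨?_, loopInvariant_initState _⟩
    rw [span_socleFamily hbb.2.2 hbb.1.1 hbb.exists_lead (hbb.2.1 0).2.1 hΛ hF', hrad]
  | socleLoop F' s s' hp _ =>
    obtain ⟨P, d, e₀, hpass⟩ := hp.isPass hc.2 fun f hf => hc.1 ▸ Ideal.subset_span hf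
    exact ⟨hc.1, hc.2.next_of_isPass hpass⟩
  | finish F' s s' hp hStopTest =>
    obtain ⟨P, d, e₀, hpass⟩ := hp.isPass hc.2 fun f hf => hc.1 ▸ Ideal.subset_span hf
    obtain ⟨hbb, -, hF⟩ := hpass.of_stable hc.2 hStopTest.1 hStopTest.2.1
    refine ⟨hbb, le_antisymm (Ideal.span_le.2 hc.2.mem_ideal) ?_⟩
    rw [← hc.1]
    exact Ideal.span_le.2 (hF hStopTest.2.2)

lemma GoodConfig.exists_trans (hJ : (Ideal.span (F : Set (Poly n))).radical ≠ ⊤) {c : Config n}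
    (hc : GoodConfig F c) (hdone : ¬ ∃ B G, c = .done B G) : ∃ c', Trans F c c' := by
  cases c with
  | main s =>
    obtain ⟨Λ, s', hp⟩ := exists_radicalPass hJ hc
    by_cases hStopTest : StopTest F s s'
    · exact ⟨_, .loopExit s s' Λ hp hStopTest⟩
    · exact ⟨_, .loop s s' Λ hp hStopTest⟩
  | socleCall B G Λ =>
    obtain ⟨F', hF'⟩ := exists_socleFamily hc.1.1.1 hc.1.exists_lead hc.2.2.2
    exact ⟨_, .socleStart B G Λ F' hF'⟩
  | socle F' s =>
    obtain ⟨s', hp⟩ := exists_borderPass hJ hc.2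
      fun f (hf : f ∈ F') => hc.1 ▸ Ideal.subset_span hf
    by_cases hStopTest : StopTest F' s s'
    · exact ⟨_, .finish F' s s' hp hStopTest⟩
    · exact ⟨_, .socleLoop F' s s' hp hStopTest⟩
  | done B G => exact absurd ⟨B, G, rfl⟩ hdone

lemma goodConfig_of_reachable (hJ : (Ideal.span (F : Set (Poly n))).radical ≠ ⊤) {c : Config n}
    (hc : Reachable F c) : GoodConfig F c := by
  induction hc with
  | refl => exact loopInvariant_initState _
  | tail _ h ih => exact ih.trans hJ h

/-- The loop of the normal form algorithm terminates. -/
lemma not_infinite_socle (hJ : (Ideal.span (F : Set (Poly n))).radical ≠ ⊤)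
    (hfin : Module.Finite ℂ (Poly n ⧸ (Ideal.span (F : Set (Poly n))).radical))
    {c : ℕ → Config n} (hc : ∀ k, Trans F (c k) (c (k + 1))) {F' : Finset (Poly n)} {s₀ : State n}
    (h0 : c 0 = .socle F' s₀) (hgood : GoodConfig F (c 0)) : False := by
  have hgoods : ∀ k, GoodConfig F (c k) := by
    intro k
    induction k with
    | zero => exact hgood
    | succ k ih => exact ih.trans hJ (hc k)
  have hs : ∀ k, ∃ s, c k = .socle F' s := by
    intro k
    induction k with
    | zero => exact ⟨s₀, h0⟩
    | succ k ih =>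
      obtain ⟨s, hs⟩ := ih
      -- Two consecutive transitions are inspected, since a finished configuration has no successor.
      have h1 := hc k
      have h2 := hc (k + 1)
      rw [hs] at h1
      generalize c (k + 1) = c' at h1 h2 ⊢
      cases h1 with
      | socleLoop _ _ s' _ _ => exact ⟨s', rfl⟩
      | finish _ _ s' _ _ => cases h2
  choose s hs using hs
  have hinv : ∀ k, LoopInvariant (Ideal.span (F : Set (Poly n))).radical (s k) ∧
      Ideal.span (F' : Set (Poly n)) = (Ideal.span (F : Set (Poly n))).radical := by
    intro k
    have := hgoods k
    rw [hs k] at this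
    exact ⟨this.2, this.1⟩
  have hstep : ∀ k, BorderPass F' (s k) (s (k + 1)) ∧ ¬ StopTest F' (s k) (s (k + 1)) := by
    intro k
    have h1 := hc k
    rw [hs k, hs (k + 1)] at h1
    cases h1 with
    | socleLoop _ _ _ h2 h3 => exact ⟨h2, h3⟩
  have hpass := fun k => (hstep k).1.isPass (hinv k).1
    fun f hf => (hinv k).2 ▸ Ideal.subset_span hf
  choose P d e₀ hpass using hpass
  rw [← (hinv 0).2] at hfin
  obtain ⟨k, hk⟩ := exists_stopTest (fun k => (hinv k).1) hpass hJ hfin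
  exact (hstep k).2 hk

/-- The main loop terminates. -/
lemma exists_not_main (hJ : (Ideal.span (F : Set (Poly n))).radical ≠ ⊤)
    (hfin : Module.Finite ℂ (Poly n ⧸ Ideal.span (F : Set (Poly n))))
    {c : ℕ → Config n} (hc : ∀ k, Trans F (c k) (c (k + 1))) (hgoods : ∀ k, GoodConfig F (c k)) :
    ∃ k, ∀ s, c k ≠ .main s := by
  by_contra! hcon
  choose s hs using hcon
  have hinv : ∀ k, LoopInvariant (Ideal.span (F : Set (Poly n))).radical (s k) := by
    intro k
    have := hgoods k
    rwa [hs k] at this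
  have hstep : ∀ k, ∃ Λ, RadicalPass F (s k) Λ (s (k + 1)) ∧ ¬ StopTest F (s k) (s (k + 1)) := by
    intro k
    have h1 := hc k
    rw [hs k, hs (k + 1)] at h1
    cases h1 with
    | loop _ _ Λ h2 h3 => exact ⟨Λ, h2, h3⟩
  choose Λ hp hStopTest using hstep
  have hpass : ∀ k, ∃ P d e₀, IsPass (Ideal.span (F : Set (Poly n))).radical F (s k) (s (k + 1))
      P d e₀ := by
    intro k
    obtain ⟨S, K, P, d, e₀, -, -, -, h⟩ := (hp k).isPass hJ (hinv k)
    exact ⟨P, d, e₀, h⟩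
  choose P d e₀ hpass using hpass
  obtain ⟨k, hk⟩ := exists_stopTest hinv hpass hJ hfin
  exact hStopTest k hk

theorem not_infinite_run (hJ : (Ideal.span (F : Set (Poly n))).radical ≠ ⊤)
    (hfin : Module.Finite ℂ (Poly n ⧸ Ideal.span (F : Set (Poly n)))) :
    ¬ ∃ c : ℕ → Config n, c 0 = start n ∧ ∀ k, Trans F (c k) (c (k + 1)) := by
  rintro ⟨c, h0, hc⟩
  have hfin' : Module.Finite ℂ (Poly n ⧸ (Ideal.span (F : Set (Poly n))).radical) :=
    Module.Finite.of_surjective (Ideal.Quotient.factorₐ ℂ Ideal.le_radical).toLinearMap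
      (Ideal.Quotient.factor_surjective Ideal.le_radical)
  have hreach : ∀ k, Reachable F (c k) := by
    intro k
    induction k with
    | zero => rw [h0]; exact .refl
    | succ k ih => exact ih.tail (hc k)
  have hgoods : ∀ k, GoodConfig F (c k) := fun k => goodConfig_of_reachable hJ (hreach k)
  have hsocle : ∀ k F' s, c k ≠ .socle F' s := fun k F' s hk =>
    not_infinite_socle (c := fun j => c (k + j)) hJ hfin' (fun j => hc (k + j)) hk (hgoods k)
  obtain ⟨k, hk⟩ := exists_not_main hJ hfin hc hgoods
  have h1 := hc k
  cases hck : c k with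
  | main s => exact hk s hck
  | socleCall B G Λ =>
    rw [hck] at h1
    generalize hc' : c (k + 1) = c' at h1
    cases h1 with
    | socleStart _ _ _ F' _ => exact hsocle (k + 1) F' _ hc'
  | socle F' s => exact hsocle k F' s hck
  | done B G =>
    rw [hck] at h1
    cases h1

end Runs

end RadicalBorderBasis

theorem mainTheorem2 {n : ℕ} (F : Finset (MvPolynomial (Fin n) ℂ))
    (hfin : {v : Fin n → ℂ | ∀ f ∈ F, MvPolynomial.eval v f = 0}.Finite)
    (hne : {v : Fin n → ℂ | ∀ f ∈ F, MvPolynomial.eval v f = 0}.Nonempty) :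
    -- the algorithm terminates: there is no infinite run
    (¬ ∃ c : ℕ → RadicalBorderBasis.Config n, c 0 = RadicalBorderBasis.start n ∧
        ∀ k, RadicalBorderBasis.Trans F (c k) (c (k + 1))) ∧
    -- it can never get stuck without having produced an output
    (∀ c, RadicalBorderBasis.Reachable F c → (¬ ∃ c', RadicalBorderBasis.Trans F c c') →
        ∃ B G, c = RadicalBorderBasis.Config.done B G) ∧
    -- some output is reached
    (∃ B G, RadicalBorderBasis.Reachable F (RadicalBorderBasis.Config.done B G)) ∧
    -- every output is correct
    (∀ B G, RadicalBorderBasis.Reachable F (RadicalBorderBasis.Config.done B G) →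
        RadicalBorderBasis.ConnectedToOne (B : Set (Fin n →₀ ℕ)) ∧
        RadicalBorderBasis.IsBorderBasis (B : Set (Fin n →₀ ℕ))
          (G : Set (MvPolynomial (Fin n) ℂ)) ∧
        Ideal.span (G : Set (MvPolynomial (Fin n) ℂ)) =
          (Ideal.span (F : Set (MvPolynomial (Fin n) ℂ))).radical ∧
        IsCompl (MvPolynomial.restrictSupport ℂ (B : Set (Fin n →₀ ℕ)))
          ((Ideal.span (F : Set (MvPolynomial (Fin n) ℂ))).radical.restrictScalars ℂ)) := by
  have hJ : (Ideal.span (F : Set (MvPolynomial (Fin n) ℂ))).radical ≠ ⊤ := by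
    intro h
    obtain ⟨v, hv⟩ := hne
    have := RadicalBorderBasis.eval_eq_zero_of_mem_radical
      (h ▸ Submodule.mem_top (x := (1 : MvPolynomial (Fin n) ℂ))) hv
    simp at this
  have hnorun := RadicalBorderBasis.not_infinite_run hJ
    (RadicalBorderBasis.finite_quotient_of_finite_zeros hfin)
  have hstuck : ∀ c, RadicalBorderBasis.Reachable F c →
      (¬ ∃ c', RadicalBorderBasis.Trans F c c') →
      ∃ B G, c = RadicalBorderBasis.Config.done B G := by
    intro c hc hno
    by_contra hdone
    exact hno ((RadicalBorderBasis.goodConfig_of_reachable hJ hc).exists_trans hJ hdone)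
  refine ⟨hnorun, hstuck, ?_, fun B G hBG => ?_⟩
  -- If no output were reachable, every reachable configuration would have a successor, and choosing
  -- successors would give an infinite run.
  · by_contra hcon
    have hnext : ∀ c : {c // RadicalBorderBasis.Reachable F c},
        ∃ c' : {c // RadicalBorderBasis.Reachable F c}, RadicalBorderBasis.Trans F c.1 c'.1 := by
      rintro ⟨c, hc⟩
      by_contra hno
      obtain ⟨B, G, rfl⟩ := hstuck c hc fun ⟨c', hc'⟩ => hno ⟨⟨c', hc.tail hc'⟩, hc'⟩
      exact hcon ⟨B, G, hc⟩
    choose next hnext using hnext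
    refine hnorun ⟨fun k => (next^[k] ⟨RadicalBorderBasis.start n, .refl⟩).1, rfl, fun k => ?_⟩
    simp only [Function.iterate_succ_apply']
    exact hnext _
  · obtain ⟨hbb, hspan⟩ := RadicalBorderBasis.goodConfig_of_reachable hJ hBG
    exact ⟨hbb.1, hbb, hspan, hspan ▸ hbb.2.2⟩
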